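/- For a set $L\subseteq[-1,1)$, a spherical $L$-code in $\mathbb{R}^d$ is a set of unit vectors in $\mathbb{R}^d$ such that the inner product of any two distinct members lies in $L$, and $N_L(d)$ denotes the largest size of a spherical $L$-code in $\mathbb{R}^d$. Let $\alpha,\beta\in(0,1)$, let $L=[-1,-\beta]\cup\{\alpha\}$, and let $\lambda=\dfrac{1-\alpha}{\alpha+\beta}$. Suppose that $p=\alpha/\beta+1$ is an integer. (a) If $p=2$ and $\lambda^2\notin\mathbb{Z}$, then there is a constant $K=K(\alpha,\beta)$ such that $N_L(d)$ is finite and $$N_L(d)\le \frac{11d}{3}+K\qquad\text{for all } d\ge 0 .$$ (b) If $p\ge 3$ and $\lambda\notin\mathbb{Z}$, then there is a constant $K=K(\alpha,\beta)$ such that $N_L(d)$ is finite and $$N_L(d)\le \Bigl(2p-\frac12\Bigr)d+K\qquad\text{for all } d\ge 0 .$$ -/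

import Mathlib

/-- A spherical `L`-code in `ℝ^d`: a set of unit vectors such that the inner product of any two
distinct members lies in `L`. -/
def IsSphericalCode (L : Set ℝ) {d : ℕ} (C : Set (EuclideanSpace ℝ (Fin d))) : Prop :=
  (∀ x ∈ C, ‖x‖ = 1) ∧ ∀ x ∈ C, ∀ y ∈ C, x ≠ y → inner ℝ x y ∈ L

/-- `N_L(d)`, the size of the largest spherical `L`-code in `ℝ^d`, as an extended natural number
(it is `⊤` when there are spherical `L`-codes of unbounded size). -/
noncomputable def maxCodeSize (L : Set ℝ) (d : ℕ) : ℕ∞ :=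
  ⨆ (C : Set (EuclideanSpace ℝ (Fin d))) (_ : IsSphericalCode L C), C.encard

/-- `L = [-1, -β] ∪ {α}`. -/
def uniacuteSet (α β : ℝ) : Set ℝ := Set.Icc (-1) (-β) ∪ {α}

/-! Up to boundedly many points, a code splits into at most `p` blocks (`exists_blocks`). By
Ramsey's theorem a large code contains large cliques with all inner products `α`. Their centers have
squared norm close to `α`, and two well separated centers have inner product at most about `-β`.
Since `α = (p - 1) β`, at most `p` centers can be mutually separated. Inside a block, each point has
a bounded number of partners with inner product different from `α`.

The Gram matrix of a block is `(1 - α) I + α J - (α + β) X`, where `X` is a weighted graph with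
bounded row sums. Linear relations with coefficient sum zero are therefore eigenvectors of `X` for
`lam = (1 - α) / (α + β)`, and `lam - X` is nonnegative on sum-zero vectors. The spectral estimate
`exists_finrank_eigenspace_le` bounds the multiplicity of `lam` by one third of the number of
vertices, except on components that are a single edge of weight `lam`, which contribute one half.
With `ρ` such edges, the block has at most `3d/2 + ρ/2 + O(1)` points (`exists_card_block_le`).

These edges are antipodal pairs `a ± y i` around one common center `a`, with the `y i` mutually
orthogonal. Hence `ρ ≤ d`, and a missing block, or one with few pairs, already gives `(2p - 1/2) d +
O(1)`. Otherwise all `p` centers exist, and extremality forces their mutual inner products to equal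
`-β`. After discarding boundedly many pairs, the inner products of the vectors `y` of different
blocks lie in `{0, ±(α + β)}`. Normalized, they form orthonormal families with mutual inner products
in `lam⁻¹ ℤ` (`card_le_or_exists_families`).

Arithmetic now limits the pairs. A common vector of two spans gives an eigenvector of an integer
matrix with eigenvalue `lam ^ 2`, and a non-integer eigenvalue has multiplicity at most half the
size (`card_add_card_le`). If `lam` is irrational with integer square, a common vector of three
spans gives the eigenvalue `lam ^ 3`. Its conjugate `-lam ^ 3` is then an eigenvalue too, which is
impossible for a product of projections (`card_add_card_add_card_le_of_irrational`). -/

open Finset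

/-! ### Weighted graphs, walks and the form of `lam - X` -/

/-- A finite weighted graph given by a symmetric matrix with zero diagonal, whose nonzero entries
are at least `1` and whose row sums are at most `R`. -/
structure IsWeightedGraph {V : Type*} [Fintype V] (X : V → V → ℝ) (R : ℕ) : Prop where
  symm : ∀ u v, X u v = X v u
  diag : ∀ u, X u u = 0
  zero_or : ∀ u v, X u v = 0 ∨ 1 ≤ X u v
  row_le : ∀ u, ∑ v, X u v ≤ R

/-- `near X j u v` says that there is a walk of length at most `j` from `u` to `v`. -/
def near {V : Type*} (X : V → V → ℝ) : ℕ → V → V → Prop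
  | 0, u, v => u = v
  | j + 1, u, v => near X j u v ∨ ∃ w, near X j u w ∧ X w v ≠ 0

/-- The value of `lam - X` at `w`. -/
def shiftOp {V : Type*} [Fintype V] (X : V → V → ℝ) (lam : ℝ) (w : V → ℝ) (u : V) : ℝ :=
  lam * w u - ∑ v, X u v * w v

/-- The quadratic form of `lam - X`. -/
def shiftForm {V : Type*} [Fintype V] (X : V → V → ℝ) (lam : ℝ) (w : V → ℝ) : ℝ :=
  ∑ u, w u * shiftOp X lam w u

/-- The quadratic form of `lam - X` is nonnegative on vectors supported in `S`. -/
def NonnegOn {V : Type*} [Fintype V] (X : V → V → ℝ) (lam : ℝ) (S : V → Prop) : Prop :=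
  ∀ w : V → ℝ, (∀ u, w u ≠ 0 → S u) → 0 ≤ shiftForm X lam w

section near
variable {V : Type*} {X : V → V → ℝ}

lemma near_refl (j : ℕ) (u : V) : near X j u u := by
  induction j with
  | zero => rfl
  | succ j ih => exact Or.inl ih

lemma near_mono {i j : ℕ} (h : i ≤ j) {u v : V} (hn : near X i u v) : near X j u v := by
  induction h with
  | refl => exact hn
  | step _ ih => exact Or.inl ih

lemma near_trans {i j : ℕ} {u v w : V} (h1 : near X i u v) (h2 : near X j v w) :
    near X (i + j) u w := by
  induction j generalizing w with
  | zero => cases h2; exact h1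
  | succ j ih =>
    rcases h2 with h2 | ⟨x, hx, hxw⟩
    · exact Or.inl (ih h2)
    · exact Or.inr ⟨x, ih hx, hxw⟩

lemma near_one {u v : V} (h : X u v ≠ 0) : near X 1 u v := Or.inr ⟨u, rfl, h⟩

lemma near_symm (hs : ∀ u v, X u v = X v u) {j : ℕ} {u v : V} (h : near X j u v) :
    near X j v u := by
  induction j generalizing v with
  | zero => exact Eq.symm h
  | succ j ih =>
    rcases h with h | ⟨w, hw, hwv⟩
    · exact Or.inl (ih h)
    · have := near_trans (near_one (X := X) (u := v) (v := w) (by rwa [hs])) (ih hw)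
      rwa [Nat.add_comm] at this

end near

namespace IsWeightedGraph
variable {V : Type*} [Fintype V] {X : V → V → ℝ} {R : ℕ}

lemma nonneg (h : IsWeightedGraph X R) (u v : V) : 0 ≤ X u v := by
  rcases h.zero_or u v with h | h <;> linarith

lemma one_le (h : IsWeightedGraph X R) {u v : V} (h0 : X u v ≠ 0) : 1 ≤ X u v :=
  (h.zero_or u v).resolve_left h0

open Classical in
lemma card_neighbors_le (h : IsWeightedGraph X R) (u : V) :
    (univ.filter (fun v => X u v ≠ 0)).card ≤ R := by
  have h1 : ((univ.filter (fun v => X u v ≠ 0)).card : ℝ) ≤ ∑ v, X u v := by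
    rw [Finset.card_eq_sum_ones, Nat.cast_sum, Finset.sum_filter]
    refine Finset.sum_le_sum fun v _ => ?_
    split_ifs with hv
    · simpa using h.one_le hv
    · exact h.nonneg u v
  exact_mod_cast h1.trans (h.row_le u)

open Classical in
lemma card_ball_le (h : IsWeightedGraph X R) (j : ℕ) (u : V) :
    (univ.filter (fun v => near X j u v)).card ≤ (R + 1) ^ j := by
  induction j with
  | zero =>
    refine (card_le_card (t := {u}) fun v hv => ?_).trans (by simp)
    exact mem_singleton.2 (mem_filter.1 hv).2.symm
  | succ j ih =>
    have hsub : univ.filter (fun v => near X (j + 1) u v) ⊆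
        (univ.filter (fun v => near X j u v)).biUnion
          (fun w => insert w (univ.filter (fun v => X w v ≠ 0))) := by
      intro v hv
      simp only [mem_filter, mem_univ, true_and, mem_biUnion, mem_insert] at hv ⊢
      rcases hv with hv | ⟨w, hw, hwv⟩
      · exact ⟨v, hv, Or.inl rfl⟩
      · exact ⟨w, hw, Or.inr hwv⟩
    refine (card_le_card hsub).trans ?_
    refine (card_biUnion_le_card_mul _ _ (R + 1) fun w _ => ?_).trans ?_
    · exact (card_insert_le _ _).trans (Nat.succ_le_succ (h.card_neighbors_le w))
    · rw [pow_succ]; exact Nat.mul_le_mul_right _ ih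

open Classical in
/-- Either a ball of radius `j` has more than `j` points or it is closed under adjacency. -/
lemma lt_card_ball_or_closed (X : V → V → ℝ) (j : ℕ) (u : V) :
    j + 1 ≤ (univ.filter (fun v => near X j u v)).card ∨
      ∀ v w, near X j u v → X v w ≠ 0 → near X j u w := by
  induction j with
  | zero =>
    left
    exact Finset.card_pos.2 ⟨u, mem_filter.2 ⟨mem_univ _, near_refl 0 u⟩⟩
  | succ j ih =>
    rcases ih with ih | ih
    · by_cases hc : ∀ v w, near X j u v → X v w ≠ 0 → near X j u w
      · right
        rintro v w (hv | ⟨x, hx, hxv⟩) hvw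
        · exact Or.inl (hc v w hv hvw)
        · exact Or.inl (hc v w (hc x v hx hxv) hvw)
      · left
        push Not at hc
        obtain ⟨v, w, hv, hvw, hw⟩ := hc
        have : univ.filter (fun v => near X j u v) ⊂ univ.filter (fun v => near X (j + 1) u v) := by
          refine Finset.ssubset_iff_subset_ne.2 ⟨fun x hx => ?_, fun he => hw ?_⟩
          · simp only [mem_filter, mem_univ, true_and] at hx ⊢
            exact Or.inl hx
          · have : w ∈ univ.filter (fun v => near X j u v) := by
              rw [he]; simp only [mem_filter, mem_univ, true_and]
              exact Or.inr ⟨v, hv, hvw⟩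
            simpa using this
        exact Nat.succ_le_of_lt (lt_of_le_of_lt ih (card_lt_card this))
    · right
      rintro v w (hv | ⟨x, hx, hxv⟩) hvw
      · exact Or.inl (ih v w hv hvw)
      · exact Or.inl (ih v w (ih x v hx hxv) hvw)

end IsWeightedGraph

lemma closed_near {V : Type*} {X : V → V → ℝ} {P : V → Prop}
    (hc : ∀ v w, P v → X v w ≠ 0 → P w) {j : ℕ} {u v : V} (hu : P u) (h : near X j u v) : P v := by
  induction j generalizing v with
  | zero => cases h; exact hu
  | succ j ih =>
    rcases h with h | ⟨w, hw, hwv⟩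
    · exact ih h
    · exact hc w v (ih hw) hwv

/-! ### Quadratic form estimates and a local spectral gap -/

section form
variable {V : Type*} [Fintype V] {X : V → V → ℝ} {lam : ℝ}

lemma NonnegOn.mono {S T : V → Prop} (h : NonnegOn X lam T) (hST : ∀ u, S u → T u) :
    NonnegOn X lam S := fun w hw => h w fun u hu => hST u (hw u hu)

lemma shiftOp_add (a b : ℝ) (w z : V → ℝ) (u : V) :
    shiftOp X lam (fun v => a * w v + b * z v) u = a * shiftOp X lam w u + b * shiftOp X lam z u := by
  simp only [shiftOp]
  have : ∀ v, X u v * (a * w v + b * z v) = a * (X u v * w v) + b * (X u v * z v) := by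
    intro v; ring
  simp only [this, Finset.sum_add_distrib, ← Finset.mul_sum]
  ring

lemma sum_mul_shiftOp_comm (hs : ∀ u v, X u v = X v u) (w z : V → ℝ) :
    ∑ u, w u * shiftOp X lam z u = ∑ u, z u * shiftOp X lam w u := by
  simp only [shiftOp, mul_sub, Finset.sum_sub_distrib, Finset.mul_sum]
  congr 1
  · exact Finset.sum_congr rfl fun u _ => by ring
  · rw [Finset.sum_comm]
    refine Finset.sum_congr rfl fun u _ => Finset.sum_congr rfl fun v _ => ?_
    rw [hs v u]; ring

lemma shiftForm_add (hs : ∀ u v, X u v = X v u) (a b : ℝ) (w z : V → ℝ) :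
    shiftForm X lam (fun v => a * w v + b * z v) =
      a ^ 2 * shiftForm X lam w + 2 * a * b * (∑ u, z u * shiftOp X lam w u)
        + b ^ 2 * shiftForm X lam z := by
  have h1 : ∀ u, (a * w u + b * z u) * shiftOp X lam (fun v => a * w v + b * z v) u =
      a ^ 2 * (w u * shiftOp X lam w u) + a * b * (z u * shiftOp X lam w u) +
      a * b * (w u * shiftOp X lam z u) + b ^ 2 * (z u * shiftOp X lam z u) := by
    intro u; rw [shiftOp_add]; ring
  simp only [shiftForm, h1, Finset.sum_add_distrib, ← Finset.mul_sum]
  rw [sum_mul_shiftOp_comm hs w z]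
  ring

/-- Schur test: AM-GM on each entry, then the row sum bound. -/
lemma shiftForm_le {R : ℕ} (h : IsWeightedGraph X R) (z : V → ℝ) :
    shiftForm X lam z ≤ (lam + R) * ∑ u, z u ^ 2 := by
  have key : -∑ u, ∑ v, z u * (X u v * z v) ≤ R * ∑ u, z u ^ 2 := by
    have h1 : -∑ u, ∑ v, z u * (X u v * z v) ≤
        ∑ u, ∑ v, (X u v * z u ^ 2 / 2 + X u v * z v ^ 2 / 2) := by
      rw [← Finset.sum_neg_distrib]
      refine Finset.sum_le_sum fun u _ => ?_
      rw [← Finset.sum_neg_distrib]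
      refine Finset.sum_le_sum fun v _ => ?_
      nlinarith [mul_nonneg (h.nonneg u v) (sq_nonneg (z u + z v))]
    have h2 : ∑ u, ∑ v, (X u v * z u ^ 2 / 2 + X u v * z v ^ 2 / 2) =
        ∑ u, (∑ v, X u v) * z u ^ 2 := by
      simp only [Finset.sum_add_distrib]
      rw [Finset.sum_comm (f := fun u v => X u v * z v ^ 2 / 2), ← Finset.sum_add_distrib]
      refine Finset.sum_congr rfl fun u _ => ?_
      rw [← Finset.sum_add_distrib, Finset.sum_mul]
      refine Finset.sum_congr rfl fun v _ => ?_
      rw [h.symm v u]; ring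
    rw [h2] at h1
    refine h1.trans ?_
    rw [Finset.mul_sum]
    exact Finset.sum_le_sum fun u _ => mul_le_mul_of_nonneg_right (h.row_le u) (sq_nonneg _)
  have : shiftForm X lam z = lam * ∑ u, z u ^ 2 + -∑ u, ∑ v, z u * (X u v * z v) := by
    simp only [shiftForm, shiftOp, mul_sub, Finset.sum_sub_distrib, Finset.mul_sum]
    rw [sub_eq_add_neg]
    congr 1
    exact Finset.sum_congr rfl fun u _ => by ring
  rw [this, add_mul]
  linarith

open Classical in
-- Cauchy–Schwarz for a form that is semidefinite only on vectors supported in `S`. With `M = lam +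
-- R` and `z` the restriction to `S` of `(lam - X) w`, test the form on `M w - z`. By `shiftForm_le`
-- the form at `z` is at most `M ‖z‖²`.
lemma sum_shiftOp_sq_le {R : ℕ} (h : IsWeightedGraph X R) (hl : 0 < lam) {S : V → Prop}
    (hS : NonnegOn X lam S) (w : V → ℝ) (hw : ∀ u, w u ≠ 0 → S u) :
    ∑ u ∈ univ.filter S, shiftOp X lam w u ^ 2 ≤ (lam + R) * shiftForm X lam w := by
  set z : V → ℝ := fun u => if S u then shiftOp X lam w u else 0 with hz
  have hM : 0 < lam + R := by positivity
  have hzw : ∑ u, z u * shiftOp X lam w u = ∑ u ∈ univ.filter S, shiftOp X lam w u ^ 2 := by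
    rw [Finset.sum_filter]
    refine Finset.sum_congr rfl fun u _ => ?_
    simp only [hz]; split_ifs <;> ring
  have hzz : ∑ u, z u ^ 2 = ∑ u ∈ univ.filter S, shiftOp X lam w u ^ 2 := by
    rw [Finset.sum_filter]
    refine Finset.sum_congr rfl fun u _ => ?_
    simp only [hz]; split_ifs <;> ring
  set A := ∑ u ∈ univ.filter S, shiftOp X lam w u ^ 2
  have h0 := hS (fun v => (lam + R) * w v + (-1) * z v) (by
    intro u hu
    by_contra hSu
    have : w u = 0 := by by_contra h'; exact hSu (hw u h')
    simp [hz, hSu, this] at hu)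
  rw [shiftForm_add h.symm, hzw] at h0
  have h1 := shiftForm_le (lam := lam) h z
  rw [hzz] at h1
  have : 0 ≤ (lam + R) * ((lam + R) * shiftForm X lam w - A) := by nlinarith
  have := nonneg_of_mul_nonneg_right this hM
  linarith

open Classical in
lemma sum_biUnion_le_sum {ι α : Type*} (s : Finset ι) (t : ι → Finset α) {f : α → ℝ}
    (hf : ∀ a, 0 ≤ f a) : ∑ a ∈ s.biUnion t, f a ≤ ∑ i ∈ s, ∑ a ∈ t i, f a := by
  induction s using Finset.induction_on with
  | empty => simp
  | insert i s hi ih =>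
    rw [Finset.biUnion_insert, Finset.sum_insert hi]
    have h2 := Finset.sum_union_inter (s₁ := t i) (s₂ := s.biUnion t) (f := f)
    have h3 : 0 ≤ ∑ a ∈ t i ∩ s.biUnion t, f a := Finset.sum_nonneg fun _ _ => hf _
    linarith

/-- The constants of the spectral gap below. -/
noncomputable def gapConst (lam M : ℝ) : ℕ → ℝ
  | 0 => 0
  | j + 1 => (1 + 2 * lam ^ 2) * gapConst lam M j + 2 * M

open Classical in
-- A quantitative Perron–Frobenius argument. A nonnegative `w` with a small form nearly satisfies
-- the eigenvalue equation, so where it is small its neighbors are small too. Smallness spreads from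
-- the zeros on `Del` and reaches the whole support in `r` steps, each multiplying the constant by
-- `1 + 2 lam ^ 2` and adding `2 (lam + R)`.
lemma sum_sq_le_gapConst {R : ℕ} (h : IsWeightedGraph X R) (hl : 0 < lam) {S Del : V → Prop}
    (hS : NonnegOn X lam S) (w : V → ℝ) (hw0 : ∀ u, 0 ≤ w u) (v0 : V) (J r : ℕ)
    (hsupp : ∀ u, w u ≠ 0 → near X J v0 u) (hDel : ∀ u, Del u → w u = 0)
    (hball : ∀ u, near X (J + r) v0 u → S u)
    (hhit : ∀ u, w u ≠ 0 → ∃ d, Del d ∧ near X r d u) :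
    ∑ u, w u ^ 2 ≤ gapConst lam (lam + R) r * shiftForm X lam w := by
  set Q := shiftForm X lam w
  have hop := sum_shiftOp_sq_le h hl hS w
    (fun u hu => hball u (near_mono (Nat.le_add_right _ _) (hsupp u hu)))
  -- The second condition shrinks as `j` grows: a predecessor on a walk from `Del` then still lies
  -- in the earlier set, and all these sets stay inside `S`.
  set A : ℕ → Finset V := fun j =>
    univ.filter (fun u => (∃ d, Del d ∧ near X j d u) ∧ near X (J + (r - j)) v0 u) with hA
  have key : ∀ j ≤ r, ∑ u ∈ A j, w u ^ 2 ≤ gapConst lam (lam + R) j * Q := by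
    intro j
    induction j with
    | zero =>
      intro _
      simp only [gapConst, zero_mul]
      refine (Finset.sum_eq_zero fun u hu => ?_).le
      obtain ⟨⟨d, hd, hdu⟩, _⟩ := (mem_filter.1 hu).2
      rw [← (show d = u from hdu), hDel d hd]; simp
    | succ j ih =>
      intro hj
      have ih := ih (by omega)
      have hsub : A (j + 1) ⊆ A j ∪ (A j).biUnion (fun v => univ.filter (fun u => X v u ≠ 0)) := by
        intro u hu
        simp only [hA, mem_filter, mem_univ, true_and] at hu
        obtain ⟨⟨d, hd, hdu⟩, hu2⟩ := hu
        rw [mem_union, mem_biUnion]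
        rcases hdu with hdu | ⟨v, hdv, hvu⟩
        · left
          simp only [hA, mem_filter, mem_univ, true_and]
          exact ⟨⟨d, hd, hdu⟩, near_mono (by omega) hu2⟩
        · right
          refine ⟨v, ?_, by simpa using hvu⟩
          simp only [hA, mem_filter, mem_univ, true_and]
          refine ⟨⟨d, hd, hdv⟩, ?_⟩
          have := near_trans hu2 (near_one (X := X) (u := u) (v := v) (by rwa [h.symm]))
          exact near_mono (by omega) this
      have h1 : ∑ u ∈ A (j + 1), w u ^ 2 ≤ ∑ u ∈ A j, w u ^ 2 +
          ∑ v ∈ A j, ∑ u ∈ univ.filter (fun u => X v u ≠ 0), w u ^ 2 := by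
        refine (Finset.sum_le_sum_of_subset_of_nonneg hsub fun _ _ _ => sq_nonneg _).trans ?_
        have h2 := Finset.sum_union_inter (s₁ := A j)
          (s₂ := (A j).biUnion (fun v => univ.filter (fun u => X v u ≠ 0))) (f := fun u => w u ^ 2)
        have h3 : 0 ≤ ∑ u ∈ A j ∩ (A j).biUnion (fun v => univ.filter (fun u => X v u ≠ 0)),
          w u ^ 2 := Finset.sum_nonneg fun _ _ => sq_nonneg _
        have h4 : ∑ u ∈ (A j).biUnion (fun v => univ.filter (fun u => X v u ≠ 0)), w u ^ 2 ≤
            ∑ v ∈ A j, ∑ u ∈ univ.filter (fun u => X v u ≠ 0), w u ^ 2 :=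
          sum_biUnion_le_sum _ _ fun _ => sq_nonneg _
        linarith
      have h5 : ∀ v ∈ A j, ∑ u ∈ univ.filter (fun u => X v u ≠ 0), w u ^ 2 ≤
          2 * lam ^ 2 * w v ^ 2 + 2 * shiftOp X lam w v ^ 2 := by
        intro v _
        -- Nonzero weights are at least `1` and `w` is nonnegative, so no cancellation can hide a
        -- large neighbor.
        have h6 : ∑ u ∈ univ.filter (fun u => X v u ≠ 0), w u ^ 2 ≤ (∑ u, X v u * w u) ^ 2 := by
          have hnn : ∀ u ∈ (univ : Finset V), 0 ≤ X v u * w u :=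
            fun u _ => mul_nonneg (h.nonneg v u) (hw0 u)
          refine le_trans ?_ (Finset.sum_sq_le_sq_sum_of_nonneg hnn)
          rw [Finset.sum_filter]
          refine Finset.sum_le_sum fun u _ => ?_
          split_ifs with hu
          · have := h.one_le hu
            have h7 : w u ≤ X v u * w u := by nlinarith [hw0 u]
            exact pow_le_pow_left₀ (hw0 u) h7 2
          · positivity
        refine h6.trans ?_
        have : ∑ u, X v u * w u = lam * w v - shiftOp X lam w v := by simp [shiftOp]
        rw [this]
        nlinarith [sq_nonneg (lam * w v + shiftOp X lam w v)]
      have h8 : ∑ v ∈ A j, shiftOp X lam w v ^ 2 ≤ (lam + R) * Q := by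
        refine le_trans (Finset.sum_le_sum_of_subset_of_nonneg ?_ fun _ _ _ => sq_nonneg _) hop
        intro v hv
        simp only [hA, mem_filter, mem_univ, true_and] at hv ⊢
        exact hball v (near_mono (by omega) hv.2)
      have h9 := Finset.sum_le_sum h5
      rw [Finset.sum_add_distrib, ← Finset.mul_sum, ← Finset.mul_sum] at h9
      simp only [gapConst]
      nlinarith [sq_nonneg lam, mul_le_mul_of_nonneg_left ih (by positivity : 0 ≤ 2 * lam ^ 2)]
  have hlast := key r le_rfl
  refine le_trans (le_of_eq ?_) hlast
  symm
  refine Finset.sum_subset (Finset.subset_univ _) fun u _ hu => ?_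
  by_contra hne
  have hne : w u ≠ 0 := fun h0 => hne (by simp [h0])
  apply hu
  simp only [hA, mem_filter, mem_univ, true_and, Nat.sub_self, add_zero]
  exact ⟨hhit u hne, hsupp u hne⟩

end form

/-! ### Eigenvectors cannot concentrate at a vertex -/

section localization
variable {V : Type*} [Fintype V] {X : V → V → ℝ} {lam : ℝ} {R : ℕ}

lemma exists_small_increment {m : ℕ → ℝ} {a : ℝ} {J : ℕ} (hJ : 0 < J) (h0 : a ≤ m 0)
    (h1 : m J ≤ 4 * a) : ∃ j < J, m (j + 1) - m j ≤ 3 * a / J := by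
  by_contra! hc
  have h2 : ∑ j ∈ range J, (3 * a / J) < ∑ j ∈ range J, (m (j + 1) - m j) :=
    Finset.sum_lt_sum_of_nonempty ⟨0, by simpa using hJ⟩ fun j hj => hc j (by simpa using hj)
  rw [Finset.sum_range_sub, Finset.sum_const, card_range, nsmul_eq_mul,
    mul_div_cancel₀ _ (by positivity)] at h2
  linarith

open Classical in
/-- Truncating the absolute value of an eigenvector to a set costs at most the boundary terms. -/
lemma shiftForm_truncate_le (h : IsWeightedGraph X R) (hl : 0 < lam) {k : V → ℝ}
    (hk : ∀ u, ∑ v, X u v * k v = lam * k u) (B : V → Prop) :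
    shiftForm X lam (fun u => if B u then |k u| else 0) ≤
      ∑ u ∈ univ.filter B, ∑ v ∈ univ.filter (fun v => ¬ B v), X u v * (|k u| * |k v|) := by
  simp only [shiftForm]
  rw [Finset.sum_filter]
  refine Finset.sum_le_sum fun u _ => ?_
  split_ifs with hu
  · have h1 : lam * |k u| ≤ ∑ v, X u v * |k v| := by
      calc lam * |k u| = |∑ v, X u v * k v| := by rw [hk, abs_mul, abs_of_pos hl]
        _ ≤ ∑ v, |X u v * k v| := Finset.abs_sum_le_sum_abs _ _
        _ = ∑ v, X u v * |k v| := by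
          refine Finset.sum_congr rfl fun v _ => ?_
          rw [abs_mul, abs_of_nonneg (h.nonneg u v)]
    have h2 : ∑ v, X u v * |k v| = (∑ v, X u v * (if B v then |k v| else 0)) +
        ∑ v ∈ univ.filter (fun v => ¬ B v), X u v * |k v| := by
      rw [Finset.sum_filter, ← Finset.sum_add_distrib]
      refine Finset.sum_congr rfl fun v _ => ?_
      by_cases hv : B v <;> simp [hv]
    have h3 : shiftOp X lam (fun u => if B u then |k u| else 0) u ≤
        ∑ v ∈ univ.filter (fun v => ¬ B v), X u v * |k v| := by
      simp only [shiftOp, hu, if_true]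
      linarith
    calc |k u| * _ ≤ |k u| * ∑ v ∈ univ.filter (fun v => ¬ B v), X u v * |k v| :=
          mul_le_mul_of_nonneg_left h3 (abs_nonneg _)
      _ = _ := by
          rw [Finset.mul_sum]
          exact Finset.sum_congr rfl fun v _ => by ring
  · simp

lemma gapConst_nonneg {M : ℝ} (hM : 0 ≤ M) (j : ℕ) : 0 ≤ gapConst lam M j := by
  induction j with
  | zero => simp [gapConst]
  | succ j ih => simp only [gapConst]; positivity

open Classical in
lemma sum_truncate_sq {k : V → ℝ} (B : V → Prop) :
    ∑ u, (if B u then |k u| else 0) ^ 2 = ∑ u ∈ univ.filter B, k u ^ 2 := by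
  rw [Finset.sum_filter]
  refine Finset.sum_congr rfl fun u _ => ?_
  split_ifs <;> simp

/-- No eigenvector of eigenvalue `lam` vanishing on `Del` is concentrated at a vertex. -/
lemma not_concentrated (h : IsWeightedGraph X R) (hl : 0 < lam) (hR : 1 ≤ R) {k : V → ℝ}
    (hk : ∀ u, ∑ v, X u v * k v = lam * k u) {Del : V → Prop} (hDel : ∀ u, Del u → k u = 0)
    {r J : ℕ} (hJ0 : 0 < J)
    (hJ : 48 * (gapConst lam (lam + R) r + 1) ^ 2 * (R : ℝ) ^ 2 ≤ J) {v0 : V}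
    (hS : NonnegOn X lam (near X (J + r) v0))
    (hhit : ∀ u, k u ≠ 0 → ∃ d, Del d ∧ near X r d u) (hv0 : k v0 ≠ 0) :
    4 * k v0 ^ 2 < ∑ u, k u ^ 2 := by
  classical
  by_contra! hcon
  set a := k v0 ^ 2
  have ha : 0 < a := by positivity
  set c := gapConst lam (lam + R) r + 1 with hc
  have hgc : 0 ≤ gapConst lam (lam + R) r := gapConst_nonneg (by positivity) r
  have hc0 : 0 < c := by linarith
  -- The mass of growing balls rises from at least `a` to at most `4 a`, so one of the `J` shells
  -- carries at most `3 a / J`. Cutting `|k|` there makes the form small, against the gap estimate.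
  obtain ⟨j, hj, hinc⟩ := exists_small_increment
    (m := fun j => ∑ u ∈ univ.filter (near X j v0), k u ^ 2) (a := a) hJ0
    (Finset.single_le_sum (f := fun u => k u ^ 2) (fun _ _ => sq_nonneg _)
      (mem_filter.2 ⟨mem_univ v0, near_refl 0 v0⟩))
    ((Finset.sum_le_sum_of_subset_of_nonneg (filter_subset _ _) fun _ _ _ => sq_nonneg _).trans
      hcon)
  set B : V → Prop := near X j v0
  set w : V → ℝ := fun u => if B u then |k u| else 0 with hw
  have hwk : ∀ u, w u ≠ 0 → B u ∧ k u ≠ 0 := by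
    intro u hu
    by_cases hB : B u
    · simp only [hw, hB, if_true] at hu
      exact ⟨hB, by simpa using hu⟩
    · simp [hw, hB] at hu
  have hgap := sum_sq_le_gapConst h hl hS w
    (fun u => by simp only [hw]; split_ifs <;> positivity) v0 J r
    (fun u hu => near_mono hj.le (hwk u hu).1)
    (fun u hu => by simp [hw, hDel u hu]) (fun u hu => hu)
    (fun u hu => hhit u (hwk u hu).2)
  have hQ0 : 0 ≤ shiftForm X lam w :=
    hS w fun u hu => near_mono (by omega) (hwk u hu).1
  rw [sum_truncate_sq] at hgap
  have hbd := shiftForm_truncate_le h hl hk B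
  change shiftForm X lam w ≤ _ at hbd
  have hRp : (0 : ℝ) < R := by exact_mod_cast hR
  -- The AM-GM weight. It makes the interior part of the boundary term exactly `a / (4 c)`; the
  -- lower bound on `J` gives the same bound for the shell part.
  set θ : ℝ := 1 / (8 * c * R) with hθ
  have hθp : 0 < θ := by positivity
  set Sh : Finset V := univ.filter (fun v => near X (j + 1) v0 v ∧ ¬ B v) with hSh
  have hShsum : ∑ u ∈ Sh, k u ^ 2 ≤ 3 * a / J := by
    refine le_trans (le_of_eq ?_) hinc
    rw [eq_sub_iff_add_eq, ← Finset.sum_union]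
    · refine Finset.sum_congr ?_ fun _ _ => rfl
      ext u
      simp only [hSh, mem_union, mem_filter, mem_univ, true_and]
      constructor
      · rintro (hu | hu)
        · exact hu.1
        · exact Or.inl hu
      · intro hu
        by_cases hB : B u
        · exact Or.inr hB
        · exact Or.inl ⟨hu, hB⟩
    · rw [Finset.disjoint_left]
      intro u hu hu'
      exact (mem_filter.1 hu).2.2 (mem_filter.1 hu').2
  have hbd2 : ∑ u ∈ univ.filter B, ∑ v ∈ univ.filter (fun v => ¬ B v), X u v * (|k u| * |k v|) ≤
      ∑ u ∈ univ.filter B, ∑ v ∈ Sh, X u v * (θ / 2 * k u ^ 2 + 1 / (2 * θ) * k v ^ 2) := by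
    refine Finset.sum_le_sum fun u hu => ?_
    have e1 : ∑ v ∈ univ.filter (fun v => ¬ B v), X u v * (|k u| * |k v|) =
        ∑ v ∈ Sh, X u v * (|k u| * |k v|) := by
      symm
      refine Finset.sum_subset (fun v hv => ?_) fun v hv hv' => ?_
      · exact mem_filter.2 ⟨mem_univ _, (mem_filter.1 hv).2.2⟩
      · by_cases hX : X u v = 0
        · simp [hX]
        · exact absurd (mem_filter.2 ⟨mem_univ _, Or.inr ⟨u, (mem_filter.1 hu).2, hX⟩,
            (mem_filter.1 hv).2⟩) hv'
    rw [e1]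
    refine Finset.sum_le_sum fun v _ => mul_le_mul_of_nonneg_left ?_ (h.nonneg u v)
    have e2 : θ / 2 * k u ^ 2 + 1 / (2 * θ) * k v ^ 2 - |k u| * |k v| =
        (θ * |k u| - |k v|) ^ 2 / (2 * θ) := by
      rw [← sq_abs (k u), ← sq_abs (k v)]
      field_simp
      ring
    have : 0 ≤ (θ * |k u| - |k v|) ^ 2 / (2 * θ) := by positivity
    linarith
  have hbd3 : ∑ u ∈ univ.filter B, ∑ v ∈ Sh, X u v * (θ / 2 * k u ^ 2 + 1 / (2 * θ) * k v ^ 2) ≤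
      θ / 2 * R * (4 * a) + 1 / (2 * θ) * R * (3 * a / J) := by
    simp only [mul_add, Finset.sum_add_distrib]
    refine add_le_add ?_ ?_
    · calc ∑ u ∈ univ.filter B, ∑ v ∈ Sh, X u v * (θ / 2 * k u ^ 2)
          ≤ ∑ u ∈ univ.filter B, R * (θ / 2 * k u ^ 2) := by
            refine Finset.sum_le_sum fun u _ => ?_
            rw [← Finset.sum_mul]
            refine mul_le_mul_of_nonneg_right (le_trans ?_ (h.row_le u)) (by positivity)
            exact Finset.sum_le_sum_of_subset_of_nonneg (subset_univ _) fun v _ _ => h.nonneg u v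
        _ = θ / 2 * R * ∑ u ∈ univ.filter B, k u ^ 2 := by
            rw [Finset.mul_sum]; exact Finset.sum_congr rfl fun u _ => by ring
        _ ≤ θ / 2 * R * (4 * a) := by
            refine mul_le_mul_of_nonneg_left (le_trans ?_ hcon) (by positivity)
            exact Finset.sum_le_sum_of_subset_of_nonneg (subset_univ _) fun v _ _ => sq_nonneg _
    · rw [Finset.sum_comm]
      calc ∑ v ∈ Sh, ∑ u ∈ univ.filter B, X u v * (1 / (2 * θ) * k v ^ 2)
          ≤ ∑ v ∈ Sh, R * (1 / (2 * θ) * k v ^ 2) := by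
            refine Finset.sum_le_sum fun v _ => ?_
            rw [← Finset.sum_mul]
            refine mul_le_mul_of_nonneg_right (le_trans ?_ (h.row_le v)) (by positivity)
            refine le_trans (Finset.sum_le_sum_of_subset_of_nonneg (subset_univ _)
              fun u _ _ => h.nonneg u v) (le_of_eq ?_)
            exact Finset.sum_congr rfl fun u _ => h.symm u v
        _ = 1 / (2 * θ) * R * ∑ v ∈ Sh, k v ^ 2 := by
            rw [Finset.mul_sum]; exact Finset.sum_congr rfl fun u _ => by ring
        _ ≤ _ := mul_le_mul_of_nonneg_left hShsum (by positivity)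
  have hJp : (0 : ℝ) < J := by exact_mod_cast hJ0
  have hQ : shiftForm X lam w ≤ a / (2 * c) := by
    refine (hbd.trans (hbd2.trans hbd3)).trans ?_
    have e1 : θ / 2 * R * (4 * a) = a / (4 * c) := by
      rw [hθ]; field_simp; ring
    have e2 : 1 / (2 * θ) * R * (3 * a / J) = a / (4 * c) * (48 * c ^ 2 * R ^ 2 / J) := by
      rw [hθ]; field_simp; ring
    have e3 : 48 * c ^ 2 * R ^ 2 / J ≤ 1 := (div_le_one hJp).2 hJ
    have e4 : a / (2 * c) = a / (4 * c) + a / (4 * c) := by field_simp; ring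
    rw [e1, e2, e4]
    have : 0 ≤ a / (4 * c) := by positivity
    nlinarith
  have hlow : a ≤ ∑ u ∈ univ.filter B, k u ^ 2 :=
    Finset.single_le_sum (f := fun u => k u ^ 2) (fun _ _ => sq_nonneg _)
      (mem_filter.2 ⟨mem_univ v0, near_refl j v0⟩)
  have hfin : a ≤ c * (a / (2 * c)) := by
    calc a ≤ gapConst lam (lam + R) r * shiftForm X lam w := hlow.trans hgap
      _ ≤ c * shiftForm X lam w := mul_le_mul_of_nonneg_right (by linarith) hQ0
      _ ≤ _ := mul_le_mul_of_nonneg_left hQ hc0.le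
  have : c * (a / (2 * c)) = a / 2 := by field_simp
  linarith

/-- An eigenvector vanishing on `Del` vanishes on a closed ball that meets `Del` everywhere. -/
lemma eq_zero_of_closed (h : IsWeightedGraph X R) (hl : 0 < lam) {k : V → ℝ}
    (hk : ∀ u, ∑ v, X u v * k v = lam * k u) {Del : V → Prop} (hDel : ∀ u, Del u → k u = 0)
    {r j : ℕ} {v0 : V} (hS : NonnegOn X lam (near X (j + r) v0))
    (hcl : ∀ v w, near X j v0 v → X v w ≠ 0 → near X j v0 w)
    (hhit : ∀ u, k u ≠ 0 → near X j v0 u → ∃ d, Del d ∧ near X r d u) : k v0 = 0 := by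
  classical
  set w : V → ℝ := fun u => if near X j v0 u then |k u| else 0 with hw
  have hwk : ∀ u, w u ≠ 0 → near X j v0 u ∧ k u ≠ 0 := by
    intro u hu
    by_cases hB : near X j v0 u
    · simp only [hw, hB, if_true] at hu
      exact ⟨hB, by simpa using hu⟩
    · simp [hw, hB] at hu
  have hgap := sum_sq_le_gapConst h hl hS w
    (fun u => by simp only [hw]; split_ifs <;> positivity) v0 j r
    (fun u hu => (hwk u hu).1)
    (fun u hu => by simp [hw, hDel u hu]) (fun u hu => hu)
    (fun u hu => hhit u (hwk u hu).2 (hwk u hu).1)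
  rw [sum_truncate_sq] at hgap
  have hbd := shiftForm_truncate_le h hl hk (near X j v0)
  change shiftForm X lam w ≤ _ at hbd
  rw [Finset.sum_eq_zero (fun u hu => Finset.sum_eq_zero fun v hv => ?_)] at hbd
  · have hgc : 0 ≤ gapConst lam (lam + R) r := gapConst_nonneg (by positivity) r
    have hlow : k v0 ^ 2 ≤ ∑ u ∈ univ.filter (near X j v0), k u ^ 2 :=
      Finset.single_le_sum (f := fun u => k u ^ 2) (fun _ _ => sq_nonneg _)
        (mem_filter.2 ⟨mem_univ v0, near_refl j v0⟩)
    have : k v0 ^ 2 ≤ 0 := by nlinarith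
    exact pow_eq_zero_iff (two_ne_zero) |>.1 (le_antisymm this (sq_nonneg _))
  · by_cases hX : X u v = 0
    · simp [hX]
    · exact absurd (hcl u v (mem_filter.1 hu).2 hX) (mem_filter.1 hv).2

end localization

/-! ### Dimension counts and the exceptional vertices -/

section counting
variable {V : Type*} [Fintype V] {X : V → V → ℝ} {lam : ℝ} {R : ℕ}

lemma finrank_le_card_add (K : Submodule ℝ (V → ℝ)) (D : Finset V) :
    Module.finrank ℝ K ≤ D.card + Module.finrank ℝ
      (K ⊓ LinearMap.ker (LinearMap.funLeft ℝ ℝ (Subtype.val : D → V)) : Submodule ℝ (V → ℝ)) := by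
  set f : K →ₗ[ℝ] (D → ℝ) := (LinearMap.funLeft ℝ ℝ (Subtype.val : D → V)).comp K.subtype
  have h1 := LinearMap.finrank_range_add_finrank_ker f
  have h2 : Module.finrank ℝ (LinearMap.range f) ≤ D.card := by
    refine (Submodule.finrank_le _).trans ?_
    simp
  have h3 : Module.finrank ℝ (LinearMap.ker f) ≤ Module.finrank ℝ
      (K ⊓ LinearMap.ker (LinearMap.funLeft ℝ ℝ (Subtype.val : D → V)) :
        Submodule ℝ (V → ℝ)) := by
    rw [← Submodule.finrank_map_subtype_eq]
    refine Submodule.finrank_mono ?_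
    rintro _ ⟨k, hk, rfl⟩
    exact ⟨k.2, hk⟩
  omega

open Classical in
/-- A space of vectors none of which is concentrated at a vertex is small. -/
lemma four_mul_finrank_le (K : Submodule ℝ (V → ℝ)) (L : Finset V)
    (hL : ∀ k ∈ K, ∀ v, v ∉ L → k v = 0)
    (hK : ∀ k ∈ K, ∀ v, k v ≠ 0 → 4 * k v ^ 2 < ∑ u, k u ^ 2) :
    4 * Module.finrank ℝ K ≤ L.card := by
  set K' : Submodule ℝ (EuclideanSpace ℝ V) :=
    K.map ((WithLp.linearEquiv 2 ℝ (V → ℝ)).symm : (V → ℝ) →ₗ[ℝ] EuclideanSpace ℝ V) with hK'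
  have hfin : Module.finrank ℝ K' = Module.finrank ℝ K := LinearEquiv.finrank_map_eq _ _
  have hmem : ∀ x ∈ K', (fun v => x v) ∈ K := by
    rintro x ⟨k, hk, rfl⟩
    exact hk
  set b := stdOrthonormalBasis ℝ K'
  set τ : V → ℝ := fun v => ∑ j, ((b j : EuclideanSpace ℝ V) v) ^ 2 with hτ
  have hsum : ∑ v, τ v = Module.finrank ℝ K' := by
    simp only [hτ]
    rw [Finset.sum_comm]
    have : ∀ j, ∑ v, ((b j : EuclideanSpace ℝ V) v) ^ 2 = 1 := by
      intro j
      have h1 := b.orthonormal.1 j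
      have h2 := EuclideanSpace.real_norm_sq_eq (b j : EuclideanSpace ℝ V)
      rw [← h2]
      have : ‖(b j : EuclideanSpace ℝ V)‖ = 1 := h1
      rw [this]; norm_num
    simp [this]
  have hτle : ∀ v, τ v ≤ if v ∈ L then 1 / 4 else 0 := by
    intro v
    split_ifs with hv
    · by_contra! hlt
      -- The orthogonal projection to `K'` of the basis vector at `v`: its `v`-coordinate and its
      -- squared norm both equal the diagonal entry `τ v`. Non-concentration reads `4 τ² < τ`.
      -- Summing the diagonal gives the trace, which is the dimension.
      set x : K' := ∑ j, ((b j : EuclideanSpace ℝ V) v) • b j with hx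
      have hxv : (x : EuclideanSpace ℝ V) v = τ v := by
        simp [hx, hτ, pow_two]
      have hxn : ∑ u, ((x : EuclideanSpace ℝ V) u) ^ 2 = τ v := by
        rw [← EuclideanSpace.real_norm_sq_eq]
        have : ‖(x : EuclideanSpace ℝ V)‖ ^ 2 = inner ℝ x x := by
          rw [real_inner_self_eq_norm_sq]; rfl
        rw [this, hx, b.orthonormal.inner_sum]
        simp [hτ, pow_two]
      have := hK _ (hmem x x.2) v (by simp only [hxv]; linarith)
      simp only [hxv, hxn] at this
      nlinarith
    · refine (Finset.sum_eq_zero fun j _ => ?_).le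
      have := hL _ (hmem (b j) (b j).2) v hv
      simp only at this
      rw [this]; norm_num
  have h1 := Finset.sum_le_sum (s := univ) fun v _ => hτle v
  rw [hsum, Finset.sum_ite_mem, hfin] at h1
  simp at h1
  have : (4 * Module.finrank ℝ K : ℝ) ≤ L.card := by linarith
  exact_mod_cast this

open Classical in
/-- The vertices around which `lam - X` is not positive semidefinite are close to each other. -/
lemma card_not_nonnegOn_le (h : IsWeightedGraph X R)
    (hpos : ∀ w : V → ℝ, ∑ u, w u = 0 → 0 ≤ shiftForm X lam w) (s : ℕ) :
    (univ.filter (fun v => ¬ NonnegOn X lam (near X s v))).card ≤ (R + 1) ^ (2 * s + 1) := by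
  by_cases hne : ∃ v0, ¬ NonnegOn X lam (near X s v0)
  swap
  · push Not at hne
    rw [Finset.filter_false_of_mem (fun v _ => not_not.2 (hne v))]
    simp
  obtain ⟨v0, hv0⟩ := hne
  refine (card_le_card fun v hv => ?_).trans (h.card_ball_le (2 * s + 1) v0)
  have hv := (mem_filter.1 hv).2
  refine mem_filter.2 ⟨mem_univ _, ?_⟩
  by_contra hfar
  simp only [NonnegOn, not_forall, not_le] at hv hv0
  obtain ⟨w, hw, hwq⟩ := hv0
  obtain ⟨z, hz, hzq⟩ := hv
  -- Two negative test vectors whose supports are neither adjacent nor overlapping have no cross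
  -- term; a sum-zero combination would then have negative form.
  have hcross : ∑ u, z u * shiftOp X lam w u = 0 := by
    refine Finset.sum_eq_zero fun u _ => ?_
    by_cases hzu : z u = 0
    · simp [hzu]
    have hu := near_symm h.symm (hz u hzu)
    have hwu : w u = 0 := by
      by_contra hwu
      exact hfar (near_mono (by omega) (near_trans (hw u hwu) hu))
    have : ∑ x, X u x * w x = 0 := by
      refine Finset.sum_eq_zero fun x _ => ?_
      by_contra hx
      have hx1 : X u x ≠ 0 := fun h0 => hx (by simp [h0])
      have hx2 : w x ≠ 0 := fun h0 => hx (by simp [h0])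
      refine hfar (near_mono (by omega) (near_trans (hw x hx2)
        (near_trans (near_one (by rwa [h.symm])) hu)))
    simp [shiftOp, hwu, this]
  set sw := ∑ u, w u
  set sz := ∑ u, z u
  have key : ∀ a b : ℝ, a * sw + b * sz = 0 →
      0 ≤ a ^ 2 * shiftForm X lam w + b ^ 2 * shiftForm X lam z := by
    intro a b hab
    have := hpos (fun u => a * w u + b * z u) (by
      rw [Finset.sum_add_distrib, ← Finset.mul_sum, ← Finset.mul_sum]; exact hab)
    rw [shiftForm_add h.symm, hcross] at this
    linarith
  by_cases hsz : sz = 0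
  · have := key 0 1 (by simp [hsz])
    linarith
  · have h1 := key sz (-sw) (by ring)
    have h2 : 0 < sz ^ 2 := by positivity
    nlinarith [sq_nonneg sw]

end counting

/-! ### Nets and small components -/

section nets
variable {V : Type*} [Fintype V] {X : V → V → ℝ}

open Classical in
/-- The number of points of a ball. -/
noncomputable def ballSize (X : V → V → ℝ) (j : ℕ) (u : V) : ℕ :=
  (univ.filter (fun v => near X j u v)).card

/-- A ball with no more points than its radius has stopped growing, so it is a whole component. -/
lemma closed_of_ballSize_le {j : ℕ} {u : V} (h : ballSize X j u ≤ j) :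
    ∀ v w, near X j u v → X v w ≠ 0 → near X j u w :=
  (IsWeightedGraph.lt_card_ball_or_closed X j u).resolve_left (by
    change ¬ j + 1 ≤ ballSize X j u; omega)

open Classical in
lemma ballSize_le_of_near (hs : ∀ u v, X u v = X v u) {j : ℕ} {u v : V} (hv : ballSize X j v ≤ j)
    (h : near X j u v) : ballSize X j u ≤ ballSize X j v := by
  refine card_le_card fun w hw => ?_
  exact mem_filter.2 ⟨mem_univ _, closed_near (closed_of_ballSize_le hv) (near_symm hs h)
    (mem_filter.1 hw).2⟩

open Classical in
lemma card_mul_le_of_separated (hs : ∀ u v, X u v = X v u) {j c : ℕ} (D T : Finset V)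
    (hsep : ∀ d ∈ D, ∀ e ∈ D, d ≠ e → ¬ near X (j + j) d e) (hc : ∀ d ∈ D, c ≤ ballSize X j d)
    (hT : ∀ d ∈ D, ∀ v, near X j d v → v ∈ T) : D.card * c ≤ T.card := by
  have hdisj : ∀ d ∈ D, ∀ e ∈ D, d ≠ e → Disjoint (univ.filter (fun v => near X j d v))
      (univ.filter (fun v => near X j e v)) := by
    intro d hd e he hde
    rw [Finset.disjoint_left]
    intro v hv hv'
    exact hsep d hd e he hde (near_trans (mem_filter.1 hv).2 (near_symm hs (mem_filter.1 hv').2))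
  calc D.card * c = ∑ _d ∈ D, c := by simp
    _ ≤ ∑ d ∈ D, ballSize X j d := Finset.sum_le_sum hc
    _ = (D.biUnion fun d => univ.filter (fun v => near X j d v)).card :=
        (Finset.card_biUnion hdisj).symm
    _ ≤ T.card := by
        refine card_le_card fun v hv => ?_
        obtain ⟨d, hd, hv⟩ := mem_biUnion.1 hv
        exact hT d hd v (mem_filter.1 hv).2

open Classical in
/-- A separated net of the vertices whose component is not tiny. -/
lemma exists_net (hs : ∀ u v, X u v = X v u) : ∃ D : Finset V,
    (∀ v, 3 ≤ ballSize X 11 v → ∃ d ∈ D, near X 22 d v) ∧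
    12 * D.card ≤ 4 * (univ.filter (fun v => 3 ≤ ballSize X 11 v ∧ ¬ 12 ≤ ballSize X 11 v)).card +
      (univ.filter (fun v => 12 ≤ ballSize X 11 v)).card := by
  -- A maximal `22`-separated set: the balls of radius `11` around it are disjoint, and the balls of
  -- radius `22` cover.
  obtain ⟨D, hD, hmax⟩ := Finset.exists_max_image
    ((univ : Finset (Finset V)).filter (fun D => (∀ d ∈ D, 3 ≤ ballSize X 11 d) ∧
      ∀ d ∈ D, ∀ e ∈ D, d ≠ e → ¬ near X 22 d e)) Finset.card ⟨∅, by simp⟩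
  obtain ⟨hD3, hsep⟩ := (mem_filter.1 hD).2
  refine ⟨D, fun v hv => ?_, ?_⟩
  · by_contra! hc
    have hvD : v ∉ D := fun h => hc v h (near_refl _ _)
    have := hmax (insert v D) (mem_filter.2 ⟨mem_univ _, ?_, ?_⟩)
    · rw [card_insert_of_notMem hvD] at this; omega
    · intro d hd
      rcases mem_insert.1 hd with rfl | hd
      exacts [hv, hD3 d hd]
    · intro d hd e he hde
      rcases mem_insert.1 hd with rfl | hd' <;> rcases mem_insert.1 he with rfl | he'
      · exact absurd rfl hde
      · exact fun h => hc e he' (near_symm hs h)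
      · exact hc d hd'
      · exact hsep d hd' e he' hde
  -- A ball with fewer than `12` points is a component and costs at least `3` vertices, all of whose
  -- balls have the same size. The other net points cost `12` vertices each.
  · have h1 := card_mul_le_of_separated hs (j := 11) (c := 3)
      (D.filter (fun v => ¬ 12 ≤ ballSize X 11 v))
      (univ.filter (fun v => 3 ≤ ballSize X 11 v ∧ ¬ 12 ≤ ballSize X 11 v))
      (fun d hd e he => hsep d (mem_filter.1 hd).1 e (mem_filter.1 he).1)
      (fun d hd => hD3 d (mem_filter.1 hd).1) (fun d hd v hv => by
        have hd2 := (mem_filter.1 hd).2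
        have h3 := hD3 d (mem_filter.1 hd).1
        have hle := ballSize_le_of_near hs (by omega : ballSize X 11 d ≤ 11) (near_symm hs hv)
        have hle' := ballSize_le_of_near hs (by omega : ballSize X 11 v ≤ 11) hv
        exact mem_filter.2 ⟨mem_univ _, by omega, by omega⟩)
    have h2 := card_mul_le_of_separated hs (j := 11) (c := 12)
      (D.filter (fun v => 12 ≤ ballSize X 11 v))
      (univ.filter (fun v => 12 ≤ ballSize X 11 v))
      (fun d hd e he => hsep d (mem_filter.1 hd).1 e (mem_filter.1 he).1)
      (fun d hd => (mem_filter.1 hd).2) (fun d hd v hv => by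
        have hd2 := (mem_filter.1 hd).2
        refine mem_filter.2 ⟨mem_univ _, ?_⟩
        by_contra hlt
        have hle := ballSize_le_of_near hs (by omega : ballSize X 11 v ≤ 11) hv
        omega)
    have h3 := Finset.card_filter_add_card_filter_not (s := D) (fun v => 12 ≤ ballSize X 11 v)
    omega

end nets

/-! ### Perfect pairs and the multiplicity of `lam` -/

open Classical in
/-- A fixed point free involution of a finite set has a transversal. -/
lemma exists_transversal {α : Type*} (P : Finset α) (σ : α → α) (hP : ∀ u ∈ P, σ u ∈ P)
    (hσ : ∀ u ∈ P, σ (σ u) = u) (hne : ∀ u ∈ P, σ u ≠ u) :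
    ∃ T ⊆ P, 2 * T.card = P.card ∧ ∀ u ∈ P, u ∈ T ↔ σ u ∉ T := by
  set r : α → α → Prop := WellOrderingRel
  have key : ∀ u ∈ P, r u (σ u) ↔ ¬ r (σ u) u := by
    intro u hu
    constructor
    · exact fun h h' => asymm h h'
    · intro h
      rcases trichotomous_of r u (σ u) with h' | h' | h'
      exacts [h', absurd h'.symm (hne u hu), absurd h' h]
  have hiff : ∀ u ∈ P, u ∈ P.filter (fun u => r u (σ u)) ↔
      σ u ∉ P.filter (fun u => r u (σ u)) := by
    intro u hu
    simp only [mem_filter, hu, hP u hu, true_and, hσ u hu]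
    exact key u hu
  refine ⟨P.filter (fun u => r u (σ u)), filter_subset _ _, ?_, hiff⟩
  have h1 : (P.filter (fun u => ¬ r u (σ u))).card = (P.filter (fun u => r u (σ u))).card := by
    refine Finset.card_bij' (fun u _ => σ u) (fun u _ => σ u) ?_ ?_ ?_ ?_
    · intro u hu
      obtain ⟨hu1, hu2⟩ := mem_filter.1 hu
      by_contra hc
      exact hu2 (mem_filter.1 ((hiff u hu1).2 hc)).2
    · intro u hu
      have hu1 := (mem_filter.1 hu).1
      refine mem_filter.2 ⟨hP u hu1, fun hc => ?_⟩
      exact (hiff u hu1).1 hu (mem_filter.2 ⟨hP u hu1, hc⟩)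
    · exact fun u hu => hσ u (mem_filter.1 hu).1
    · exact fun u hu => hσ u (mem_filter.1 hu).1
  have h2 := Finset.card_filter_add_card_filter_not (s := P) (fun u => r u (σ u))
  omega

/-- `u` and `v` form a component with a single edge, of weight `lam`. -/
def IsPerfectPair {V : Type*} (X : V → V → ℝ) (lam : ℝ) (u v : V) : Prop :=
  X u v = lam ∧ (∀ w, w ≠ v → X u w = 0) ∧ ∀ w, w ≠ u → X v w = 0

section perfect
variable {V : Type*} {X : V → V → ℝ} {lam : ℝ} {R : ℕ}

lemma IsPerfectPair.symm (hs : ∀ u v, X u v = X v u) {u v : V} (h : IsPerfectPair X lam u v) :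
    IsPerfectPair X lam v u := ⟨by rw [hs]; exact h.1, h.2.2, h.2.1⟩

lemma IsPerfectPair.unique (hl : 0 < lam) {u v w : V} (h : IsPerfectPair X lam u v)
    (h' : IsPerfectPair X lam u w) : v = w := by
  by_contra hne
  have := h'.2.1 v hne
  rw [h.1] at this
  exact hl.ne' this

variable [Fintype V]

open Classical in
/-- The vertices of perfect pairs, and a choice of one vertex from each pair. -/
lemma exists_perfect_reps (h : IsWeightedGraph X R) (hl : 0 < lam) :
    ∃ T : Finset V, 2 * T.card = (univ.filter (fun u => ∃ v, IsPerfectPair X lam u v)).card ∧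
      (∀ u ∈ T, ∃ v, v ∉ T ∧ IsPerfectPair X lam u v) ∧
      ∀ u v, IsPerfectPair X lam u v → u ∈ T ∨ v ∈ T := by
  set P : Finset V := univ.filter (fun u => ∃ v, IsPerfectPair X lam u v) with hP
  set σ : V → V := fun u => if hu : ∃ v, IsPerfectPair X lam u v then hu.choose else u
  have hσ : ∀ u ∈ P, IsPerfectPair X lam u (σ u) := by
    intro u hu
    have hu := (mem_filter.1 hu).2
    simp only [σ, hu, dif_pos]
    exact hu.choose_spec
  have hσP : ∀ u ∈ P, σ u ∈ P := fun u hu =>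
    mem_filter.2 ⟨mem_univ _, u, (hσ u hu).symm h.symm⟩
  obtain ⟨T, hTP, hT, hiff⟩ := exists_transversal P σ hσP
    (fun u hu => (hσ _ (hσP u hu)).unique hl ((hσ u hu).symm h.symm))
    (fun u hu he => by
      have := (hσ u hu).1
      rw [he, h.diag] at this
      exact hl.ne this)
  refine ⟨T, hT, fun u hu => ⟨σ u, (hiff u (hTP hu)).1 hu, hσ u (hTP hu)⟩, fun u v huv => ?_⟩
  have hu : u ∈ P := mem_filter.2 ⟨mem_univ _, v, huv⟩
  have : v = σ u := huv.unique hl (hσ u hu)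
  rw [this]
  by_cases huT : u ∈ T
  · exact Or.inl huT
  · right
    by_contra hc
    exact huT ((hiff u hu).2 hc)

/-- Eigenvectors vanish on components with at most two vertices that are not perfect pairs. -/
lemma eq_zero_or_perfect (h : IsWeightedGraph X R) (hl : 0 < lam) {k : V → ℝ}
    (hk : ∀ u, ∑ v, X u v * k v = lam * k u) {u : V} (hu : ballSize X 11 u < 3) :
    k u = 0 ∨ ∃ v, IsPerfectPair X lam u v := by
  classical
  have hmem : ∀ w, near X 11 u w → w ∈ univ.filter (fun v => near X 11 u v) :=
    fun w hw => mem_filter.2 ⟨mem_univ _, hw⟩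
  by_cases hv : ∃ v, X u v ≠ 0
  · obtain ⟨v, hv⟩ := hv
    have huv : u ≠ v := by rintro rfl; exact hv (h.diag u)
    have hthree : ∀ w, near X 11 u w → w = u ∨ w = v := by
      intro w hw
      by_contra! hc
      have hsub : ({u, v, w} : Finset V) ⊆ univ.filter (fun v => near X 11 u v) := by
        intro x hx
        simp only [mem_insert, mem_singleton] at hx
        rcases hx with rfl | rfl | rfl
        exacts [hmem _ (near_refl _ _), hmem _ (near_mono (by omega) (near_one hv)), hmem _ hw]
      have := card_le_card hsub
      rw [card_eq_three.2 ⟨u, v, w, huv, hc.1.symm, hc.2.symm, rfl⟩] at this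
      change 3 ≤ ballSize X 11 u at this
      omega
    have h1 : ∀ w, w ≠ v → X u w = 0 := by
      intro w hw
      by_contra hX
      rcases hthree w (near_mono (by omega) (near_one hX)) with rfl | rfl
      exacts [hX (h.diag _), hw rfl]
    have h2 : ∀ w, w ≠ u → X v w = 0 := by
      intro w hw
      by_contra hX
      rcases hthree w (near_mono (by omega) (near_trans (near_one hv) (near_one hX))) with rfl | rfl
      exacts [hw rfl, hX (h.diag _)]
    have e1 := hk u
    have e2 := hk v
    rw [Finset.sum_eq_single v (fun w _ hw => by rw [h1 w hw, zero_mul]) (by simp)] at e1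
    rw [Finset.sum_eq_single u (fun w _ hw => by rw [h2 w hw, zero_mul]) (by simp),
      h.symm v u] at e2
    by_cases hku : k u = 0
    · exact Or.inl hku
    · right
      -- On a component with one edge the eigenvalues are plus and minus its weight.
      have e3 : (X u v ^ 2 - lam ^ 2) * k u = 0 := by linear_combination X u v * e2 + lam * e1
      have e4 := (mul_eq_zero.1 e3).resolve_right hku
      have e5 : X u v = lam := by
        have := h.nonneg u v
        have e6 : (X u v - lam) * (X u v + lam) = 0 := by linear_combination e4
        rcases mul_eq_zero.1 e6 with e7 | e7 <;> linarith
      exact ⟨v, e5, h1, h2⟩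
  · left
    push Not at hv
    have e1 := hk u
    simp only [hv, zero_mul, Finset.sum_const_zero] at e1
    exact (mul_eq_zero.1 e1.symm).resolve_left hl.ne'

open Classical in
/-- The multiplicity of `lam` as an eigenvalue of a weighted graph all of whose eigenvalues but
possibly one are at most `lam`. -/
theorem exists_finrank_eigenspace_le (lam : ℝ) (hl : 0 < lam) (R : ℕ) (hR : 1 ≤ R) :
    ∃ C : ℝ, ∀ {V : Type} [Fintype V] {X : V → V → ℝ}, IsWeightedGraph X R →
      (∀ w : V → ℝ, ∑ u, w u = 0 → 0 ≤ shiftForm X lam w) → ∀ K : Submodule ℝ (V → ℝ),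
      (∀ k ∈ K, ∀ u, ∑ v, X u v * k v = lam * k u) → ∀ a : ℕ,
      2 * a = (univ.filter (fun u => ∃ v, IsPerfectPair X lam u v)).card →
      (Module.finrank ℝ K : ℝ) ≤ a + ((Fintype.card V : ℝ) - 2 * a) / 3 + C := by
  obtain ⟨J0, hJ0⟩ := exists_nat_ge (48 * (gapConst lam (lam + R) 22 + 1) ^ 2 * (R : ℝ) ^ 2)
  -- The value `11` makes `J` positive and lets the balls of radius `J + 22` contain those of radius
  -- `11 + 22` needed for small components.
  set J := max J0 11 with hJ
  refine ⟨((R + 1) ^ (2 * (J + 22) + 1) : ℕ), ?_⟩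
  intro V _ X h hpos K hK a ha
  obtain ⟨T, hT, -, hTmem⟩ := exists_perfect_reps h hl
  obtain ⟨D, hDnet, hDcard⟩ := exists_net h.symm
  set U := univ.filter (fun v => ¬ NonnegOn X lam (near X (J + 22) v)) with hU
  have hUcard : U.card ≤ (R + 1) ^ (2 * (J + 22) + 1) := by
    rw [hU]
    convert card_not_nonnegOn_le h hpos (J + 22)
  set L := univ.filter (fun v => 12 ≤ ballSize X 11 v) with hL
  -- Vanishing on `T` removes the perfect pairs, on `D` makes the local gap available, and on `U`
  -- avoids the places where `lam - X` is not locally nonnegative.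
  set K0 : Submodule ℝ (V → ℝ) := K ⊓ LinearMap.ker
    (LinearMap.funLeft ℝ ℝ (Subtype.val : (T ∪ D ∪ U : Finset V) → V)) with hK0
  have hK0mem : ∀ k ∈ K0, ∀ v ∈ T ∪ D ∪ U, k v = 0 := by
    intro k hk v hv
    exact congrFun (LinearMap.mem_ker.1 hk.2) ⟨v, hv⟩
  have hsmall : ∀ k ∈ K0, ∀ v, k v ≠ 0 → 3 ≤ ballSize X 11 v := by
    intro k hk v hv
    by_contra hlt
    rcases eq_zero_or_perfect h hl (hK k hk.1) (by omega : ballSize X 11 v < 3) with h0 | ⟨w, hw⟩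
    · exact hv h0
    · rcases hTmem v w hw with hvT | hwT
      · exact hv (hK0mem k hk v (by simp [hvT]))
      · have h1 := hK k hk.1 v
        rw [Finset.sum_eq_single w (fun x _ hx => by rw [hw.2.1 x hx, zero_mul]) (by simp),
          hK0mem k hk w (by simp [hwT]), mul_zero] at h1
        exact hv ((mul_eq_zero.1 h1.symm).resolve_left hl.ne')
  have hhit : ∀ k ∈ K0, ∀ u, k u ≠ 0 → ∃ d, d ∈ T ∪ D ∪ U ∧ near X 22 d u := by
    intro k hk u hu
    obtain ⟨d, hd, hdu⟩ := hDnet u (hsmall k hk u hu)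
    exact ⟨d, by simp [hd], hdu⟩
  have hNon : ∀ k ∈ K0, ∀ v, k v ≠ 0 → NonnegOn X lam (near X (J + 22) v) := by
    intro k hk v hv
    by_contra hc
    exact hv (hK0mem k hk v (by simp [hU, hc]))
  have h4 : 4 * Module.finrank ℝ K0 ≤ L.card := by
    refine four_mul_finrank_le K0 L (fun k hk v hv => ?_) fun k hk v hv => ?_
    · by_contra hkv
      have hle : ballSize X 11 v ≤ 11 := by
        have : ¬ 12 ≤ ballSize X 11 v := fun hc => hv (mem_filter.2 ⟨mem_univ _, hc⟩)
        omega
      exact hkv (eq_zero_of_closed h hl (hK k hk.1) (Del := fun u => u ∈ T ∪ D ∪ U)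
        (hK0mem k hk) (r := 22) (j := 11)
        ((hNon k hk v hkv).mono fun u hu => near_mono (by omega) hu)
        (closed_of_ballSize_le hle) fun u hu _ => hhit k hk u hu)
    · exact not_concentrated h hl hR (hK k hk.1) (Del := fun u => u ∈ T ∪ D ∪ U)
        (hK0mem k hk) (r := 22) (J := J) (by omega)
        (hJ0.trans (by exact_mod_cast le_max_left _ _)) (hNon k hk v hv) (hhit k hk) hv
  have h5 : Module.finrank ℝ K ≤ _ + Module.finrank ℝ K0 := finrank_le_card_add K (T ∪ D ∪ U)
  have h6 : (T ∪ D ∪ U).card ≤ T.card + D.card + U.card :=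
    (card_union_le _ _).trans (Nat.add_le_add_right (card_union_le _ _) _)
  set S := univ.filter (fun v => 3 ≤ ballSize X 11 v ∧ ¬ 12 ≤ ballSize X 11 v) with hS
  set P := univ.filter (fun u => ∃ v, IsPerfectPair X lam u v) with hP
  have hPsmall : ∀ u ∈ P, ballSize X 11 u < 3 := by
    intro u hu
    obtain ⟨v, hv⟩ := (mem_filter.1 hu).2
    have hsub : univ.filter (fun w => near X 11 u w) ⊆ {u, v} := by
      intro w hw
      have := closed_near (P := fun x => x = u ∨ x = v) (X := X) (by
        rintro x y (rfl | rfl) hxy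
        · right; by_contra hne; exact hxy (hv.2.1 y hne)
        · left; by_contra hne; exact hxy (hv.2.2 y hne)) (Or.inl rfl) (mem_filter.1 hw).2
      simpa using this
    have := (card_le_card hsub).trans card_le_two
    change ballSize X 11 u ≤ 2 at this
    omega
  have h7 : P.card + S.card + L.card ≤ Fintype.card V := by
    rw [← Finset.card_union_of_disjoint, ← Finset.card_union_of_disjoint]
    · exact Finset.card_le_univ _
    · rw [Finset.disjoint_left]
      intro u hu hu'
      have h2 := (mem_filter.1 hu').2
      rcases mem_union.1 hu with hu | hu
      · have := hPsmall u hu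
        omega
      · exact (mem_filter.1 hu).2.2 h2
    · rw [Finset.disjoint_left]
      intro u hu hu'
      have := hPsmall u hu
      have := (mem_filter.1 hu').2.1
      omega
  -- A vertex of `S` contributes `1/3` through `D`; a vertex of `L` contributes `1/12` through `D`
  -- and `1/4` through `K0`, again `1/3`.
  have h8 : 3 * Module.finrank ℝ K ≤ 3 * a + (Fintype.card V - 2 * a) +
      3 * (R + 1) ^ (2 * (J + 22) + 1) := by
    have : 2 * a ≤ Fintype.card V := by omega
    omega
  have h9 : 2 * a ≤ Fintype.card V := by omega
  have h10 : (3 * Module.finrank ℝ K : ℝ) ≤ 3 * a + ((Fintype.card V : ℝ) - 2 * a) +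
      3 * ((R + 1) ^ (2 * (J + 22) + 1) : ℕ) := by
    have : ((3 * Module.finrank ℝ K : ℕ) : ℝ) ≤ ((3 * a + (Fintype.card V - 2 * a) +
      3 * (R + 1) ^ (2 * (J + 22) + 1) : ℕ) : ℝ) := by exact_mod_cast h8
    rw [Nat.cast_add, Nat.cast_add, Nat.cast_sub h9] at this
    push_cast at this ⊢
    linarith
  linarith

end perfect

/-! ### Non-integer eigenvalues of integer matrices -/

section integerMatrices
open Polynomial

lemma exists_int_of_isIntegral_rat {μ : ℝ} (h : IsIntegral ℤ μ) {q : ℚ} (hq : (q : ℝ) = μ) :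
    ∃ n : ℤ, μ = n := by
  have h1 : IsIntegral ℤ q := by
    rw [← hq] at h
    exact (isIntegral_algebraMap_iff (R := ℤ) (A := ℚ) (B := ℝ)
      (algebraMap ℚ ℝ).injective).1 h
  obtain ⟨n, hn⟩ := IsIntegrallyClosed.isIntegral_iff.1 h1
  refine ⟨n, ?_⟩
  rw [← hq, ← hn]
  simp

/-- A real number that is not an integer is a root of multiplicity at most half of the degree of
a monic integer polynomial. -/
lemma two_mul_rootMultiplicity_le {f : ℤ[X]} (hf : f.Monic) {μ : ℝ} (hμ : ¬ ∃ n : ℤ, μ = n) :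
    2 * (f.map (Int.castRingHom ℝ)).rootMultiplicity μ ≤ f.natDegree := by
  set F : ℚ[X] := f.map (Int.castRingHom ℚ) with hF
  have hFm : F.Monic := hf.map _
  have hFR : f.map (Int.castRingHom ℝ) = F.map (algebraMap ℚ ℝ) := by
    rw [hF, Polynomial.map_map]
    congr 1
  have hFdeg : F.natDegree = f.natDegree := hf.natDegree_map _
  rw [hFR, ← hFdeg]
  by_cases hroot : aeval μ F = 0
  swap
  · rw [Polynomial.rootMultiplicity_eq_zero]
    · omega
    · rwa [IsRoot.def, eval_map_algebraMap]
  have hintZ : IsIntegral ℤ μ := ⟨f, hf, by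
    have : aeval μ f = 0 := by
      rw [hF] at hroot
      rw [← hroot]
      exact (aeval_map_algebraMap ℚ μ f).symm
    simpa [aeval_def] using this⟩
  have hint : IsIntegral ℚ μ := ⟨F, hFm, by simpa [aeval_def] using hroot⟩
  set q := minpoly ℚ μ with hq
  have hqirr : Irreducible q := minpoly.irreducible hint
  have hqm : q.Monic := minpoly.monic hint
  -- A rational algebraic integer is an integer, so the minimal polynomial of `μ` is not linear.
  have hqdeg : 2 ≤ q.natDegree := by
    have h1 : 0 < q.natDegree := minpoly.natDegree_pos hint
    by_contra hlt
    have h2 : q.natDegree = 1 := by omega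
    have h3 := minpoly.natDegree_eq_one_iff.1 h2
    obtain ⟨r, hr⟩ := h3
    exact hμ (exists_int_of_isIntegral_rat hintZ (by simpa using hr))
  obtain ⟨g, hFg, hg⟩ := (FiniteMultiplicity.of_not_isUnit
    hqirr.not_isUnit hFm.ne_zero).exists_eq_pow_mul_and_not_dvd
  set k := multiplicity q F
  have hg0 : g ≠ 0 := by rintro rfl; exact hg (dvd_zero _)
  have hinj := (algebraMap ℚ ℝ).injective
  have hmap0 : (F.map (algebraMap ℚ ℝ)) ≠ 0 := (hFm.map _).ne_zero
  have h1 : (F.map (algebraMap ℚ ℝ)).rootMultiplicity μ ≤ k := by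
    rw [hFg, Polynomial.map_mul, Polynomial.map_pow] at hmap0 ⊢
    rw [Polynomial.rootMultiplicity_mul hmap0]
    have h2 : (g.map (algebraMap ℚ ℝ)).rootMultiplicity μ = 0 := by
      apply Polynomial.rootMultiplicity_eq_zero
      rw [IsRoot.def, eval_map_algebraMap]
      exact fun h => hg (minpoly.dvd ℚ μ h)
    have h3 : (q.map (algebraMap ℚ ℝ)).rootMultiplicity μ ≤ 1 :=
      Polynomial.rootMultiplicity_le_one_of_separable (hqirr.separable.map) μ
    have h4 : ((q.map (algebraMap ℚ ℝ)) ^ k).rootMultiplicity μ ≤ k := by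
      rw [← Polynomial.count_roots, Polynomial.roots_pow, Multiset.count_nsmul,
        Polynomial.count_roots]
      nlinarith
    omega
  have h5 : k * q.natDegree ≤ F.natDegree := by
    conv_rhs => rw [hFg]
    rw [Polynomial.natDegree_mul (pow_ne_zero _ hqm.ne_zero) hg0, hqm.natDegree_pow]
    exact Nat.le_add_right _ _
  nlinarith

variable {n : Type*} [Fintype n] [DecidableEq n]

/-- Geometric multiplicity is at most algebraic multiplicity, and the characteristic polynomial is
monic with integer coefficients. -/
lemma two_mul_finrank_eigenspace_le (M : Matrix n n ℤ) {μ : ℝ} (hμ : ¬ ∃ m : ℤ, μ = m) :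
    2 * Module.finrank ℝ (Module.End.eigenspace (Matrix.toLin' (M.map (Int.cast : ℤ → ℝ))) μ) ≤
      Fintype.card n := by
  have h1 := LinearMap.finrank_genEigenspace_le (Matrix.toLin' (M.map (Int.cast : ℤ → ℝ))) μ 1
  have h2 : (Matrix.toLin' (M.map (Int.cast : ℤ → ℝ))).charpoly =
      M.charpoly.map (Int.castRingHom ℝ) := by
    rw [Matrix.charpoly_toLin', ← Matrix.charpoly_map]
    rfl
  rw [h2] at h1
  have h3 := two_mul_rootMultiplicity_le M.charpoly_monic hμ
  rw [Matrix.charpoly_natDegree_eq_dim] at h3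
  change Module.finrank ℝ (Module.End.eigenspace _ μ) ≤ _ at h1
  omega

/-- Conjugation of quadratic irrational eigenvalues of integer matrices. -/
lemma hasEigenvalue_neg (M : Matrix n n ℤ) {μ : ℝ} (hirr : Irrational μ) {N : ℤ}
    (hN : μ ^ 2 = N)
    (h : Module.End.HasEigenvalue (Matrix.toLin' (M.map (Int.cast : ℤ → ℝ))) μ) :
    Module.End.HasEigenvalue (Matrix.toLin' (M.map (Int.cast : ℤ → ℝ))) (-μ) := by
  have h2 : (Matrix.toLin' (M.map (Int.cast : ℤ → ℝ))).charpoly =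
      M.charpoly.map (Int.castRingHom ℝ) := by
    rw [Matrix.charpoly_toLin', ← Matrix.charpoly_map]
    rfl
  rw [Module.End.hasEigenvalue_iff_isRoot_charpoly, h2, IsRoot.def, eval_map] at h ⊢
  set f := M.charpoly
  have hm : (X ^ 2 - C N : ℤ[X]).Monic := monic_X_pow_sub_C N two_ne_zero
  have hdiv := modByMonic_add_div f (X ^ 2 - C N)
  set r := f %ₘ (X ^ 2 - C N) with hr
  have hrdeg : r.natDegree ≤ 1 := by
    have := natDegree_modByMonic_lt f hm (by
      intro h1
      have := congrArg natDegree h1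
      rw [natDegree_X_pow_sub_C, natDegree_one] at this
      omega)
    rw [natDegree_X_pow_sub_C, ← hr] at this
    omega
  obtain ⟨b, c, hbc⟩ := exists_eq_X_add_C_of_natDegree_le_one hrdeg
  -- At both square roots of `N` the characteristic polynomial agrees with its linear remainder `b x
  -- + c`. A root at the irrational `μ` forces `b = c = 0`.
  have hev : ∀ x : ℝ, x ^ 2 = N → eval₂ (Int.castRingHom ℝ) x f = b * x + c := by
    intro x hx
    rw [← hdiv, hbc]
    rw [eval₂_add, eval₂_mul, eval₂_sub, eval₂_pow, eval₂_X, eval₂_C, eval₂_add, eval₂_mul,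
      eval₂_X, eval₂_C, eval₂_C, hx]
    simp
  rw [hev μ hN] at h
  have hb : b = 0 := by
    by_contra hb
    apply hirr
    refine ⟨-c / b, ?_⟩
    have : (b : ℝ) ≠ 0 := by exact_mod_cast hb
    push_cast
    field_simp
    linarith
  rw [hev (-μ) (by rw [neg_sq, hN])]
  simp [hb] at h ⊢
  exact h

end integerMatrices

/-! ### Orthonormal families with inner products in `lam⁻¹ ℤ` -/

section orthonormal
variable {E : Type*} [NormedAddCommGroup E] [InnerProductSpace ℝ E]
variable {ι κ τ : Type*} [Fintype ι] [Fintype κ] [Fintype τ]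

/-- The orthogonal projection to the span of an orthonormal family. -/
noncomputable def famProj (f : ι → E) (x : E) : E := ∑ i, inner ℝ (f i) x • f i

lemma famProj_of_mem {f : ι → E} (hf : Orthonormal ℝ f) {x : E}
    (hx : x ∈ Submodule.span ℝ (Set.range f)) : famProj f x = x := by
  obtain ⟨c, rfl⟩ := (Submodule.mem_span_range_iff_exists_fun ℝ).1 hx
  simp only [famProj, hf.inner_right_fintype]

lemma inner_famProj (f : ι → E) (x y : E) :
    inner ℝ y (famProj f x) = ∑ i, inner ℝ (f i) x * inner ℝ y (f i) := by
  simp [famProj, inner_sum, inner_smul_right]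

lemma norm_sub_famProj_sq {f : ι → E} (hf : Orthonormal ℝ f) (x : E) :
    ‖x - famProj f x‖ ^ 2 = ‖x‖ ^ 2 - ‖famProj f x‖ ^ 2 := by
  have h1 : inner ℝ x (famProj f x) = ‖famProj f x‖ ^ 2 := by
    have h2 : inner ℝ (famProj f x) (famProj f x) = inner ℝ x (famProj f x) := by
      conv_lhs => rw [famProj, hf.inner_sum]
      rw [inner_famProj]
      refine Finset.sum_congr rfl fun i _ => ?_
      rw [real_inner_comm x (f i)]; simp
    rw [← h2, real_inner_self_eq_norm_sq]
  rw [norm_sub_sq_real, h1]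
  ring

lemma famProj_eq_self {f : ι → E} (hf : Orthonormal ℝ f) {x : E}
    (h : ‖x‖ ≤ ‖famProj f x‖) : famProj f x = x := by
  have h1 := norm_sub_famProj_sq hf x
  have h2 : ‖x‖ ^ 2 ≤ ‖famProj f x‖ ^ 2 := pow_le_pow_left₀ (norm_nonneg _) h 2
  have h3 : ‖x - famProj f x‖ ^ 2 = 0 := le_antisymm (by linarith) (sq_nonneg _)
  have h4 := norm_eq_zero.1 (pow_eq_zero_iff two_ne_zero |>.1 h3)
  exact (sub_eq_zero.1 h4).symm

lemma norm_famProj_le {f : ι → E} (hf : Orthonormal ℝ f) (x : E) : ‖famProj f x‖ ≤ ‖x‖ := by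
  have h1 := norm_sub_famProj_sq hf x
  have h2 := sq_nonneg ‖x - famProj f x‖
  exact le_of_sq_le_sq (by linarith) (norm_nonneg _)

lemma inner_eq_sum {g : κ → E} (hg : Orthonormal ℝ g) {x : E}
    (hx : x ∈ Submodule.span ℝ (Set.range g)) (y : E) :
    inner ℝ y x = ∑ j, inner ℝ y (g j) * inner ℝ (g j) x := by
  conv_lhs => rw [← famProj_of_mem hg hx, inner_famProj]
  exact Finset.sum_congr rfl fun j _ => mul_comm _ _

lemma mulVec_inner {σ : Type*} {lam t : ℝ} {f : σ → E} {g : κ → E} {A : σ → κ → ℤ}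
    (hA : ∀ i j, lam * inner ℝ (f i) (g j) = A i j) (z : E) :
    ((Matrix.of A).map (Int.cast : ℤ → ℝ)).mulVec (fun j => t * inner ℝ (g j) z) =
      fun i => t * lam * inner ℝ (f i) (famProj g z) := by
  ext i
  simp only [Matrix.mulVec, dotProduct, Matrix.map_apply, Matrix.of_apply, ← hA, inner_famProj,
    Finset.mul_sum]
  exact Finset.sum_congr rfl fun l _ => by ring

variable [FiniteDimensional ℝ E]

/-- Two orthonormal families with inner products in `lam⁻¹ ℤ` have a small common span if `lam ^ 2`
is not an integer. -/
lemma card_add_card_le {lam : ℝ} (hlam : ¬ ∃ n : ℤ, lam ^ 2 = n)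
    {f : ι → E} {g : κ → E} (hf : Orthonormal ℝ f) (hg : Orthonormal ℝ g)
    (hfg : ∀ i j, ∃ m : ℤ, lam * inner ℝ (f i) (g j) = m) :
    Fintype.card ι + 2 * Fintype.card κ ≤ 2 * Module.finrank ℝ E := by
  classical
  choose A hA using hfg
  set M : Matrix ι ι ℤ := Matrix.of A * (Matrix.of A).transpose with hM
  set W := Submodule.span ℝ (Set.range f) ⊓ Submodule.span ℝ (Set.range g) with hW
  have hdim := Submodule.finrank_sup_add_finrank_inf_eq (Submodule.span ℝ (Set.range f))
    (Submodule.span ℝ (Set.range g))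
  rw [finrank_span_eq_card hf.linearIndependent, finrank_span_eq_card hg.linearIndependent] at hdim
  have hle : Module.finrank ℝ (Submodule.span ℝ (Set.range f) ⊔ Submodule.span ℝ (Set.range g) :
    Submodule ℝ E) ≤ Module.finrank ℝ E := Submodule.finrank_le _
  -- The coordinates in `f` of a common vector. Expanding it in `g` and then again in `f` shows that
  -- they form an eigenvector of `A Aᵀ` for `lam ^ 2`.
  set c : W →ₗ[ℝ] (ι → ℝ) :=
    (LinearMap.pi fun i => (innerSL ℝ (f i)).toLinearMap).comp W.subtype with hc
  have hcapp : ∀ x : W, ∀ i, c x i = inner ℝ (f i) (x : E) := fun x i => rfl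
  have heig : ∀ x, c x ∈ Module.End.eigenspace
      (Matrix.toLin' (M.map (Int.cast : ℤ → ℝ))) (lam ^ 2) := by
    intro x
    rw [Module.End.mem_eigenspace_iff]
    ext i
    rw [Matrix.toLin'_apply, Matrix.mulVec, dotProduct]
    simp only [hcapp, Pi.smul_apply, smul_eq_mul, Matrix.map_apply, hM, Matrix.mul_apply,
      Matrix.transpose_apply, Matrix.of_apply]
    push_cast
    simp only [← hA, Finset.sum_mul]
    rw [Finset.sum_comm, inner_eq_sum hg x.2.2 (f i), Finset.mul_sum]
    refine Finset.sum_congr rfl fun j _ => ?_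
    rw [inner_eq_sum hf x.2.1 (g j), Finset.mul_sum, Finset.mul_sum]
    refine Finset.sum_congr rfl fun i' _ => ?_
    rw [real_inner_comm (f i') (g j)]
    ring
  have hinj : Function.Injective (c.codRestrict _ heig) := by
    intro x y hxy
    have h1 : c x = c y := congrArg Subtype.val hxy
    apply Subtype.ext
    rw [← famProj_of_mem hf x.2.1, ← famProj_of_mem hf y.2.1, famProj, famProj]
    refine Finset.sum_congr rfl fun i _ => ?_
    rw [← hcapp, ← hcapp, h1]
  have h2 := LinearMap.finrank_le_finrank_of_injective hinj
  have h3 := two_mul_finrank_eigenspace_le M hlam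
  rw [hW] at h2
  omega

/-- Three orthonormal families with mutual inner products in `lam⁻¹ ℤ` span subspaces with trivial
intersection if `lam` is irrational with integer square. -/
lemma card_add_card_add_card_le_of_irrational {lam : ℝ} (hlam : Irrational lam) {N : ℤ}
    (hN : lam ^ 2 = N) {f : ι → E} {g : κ → E} {h : τ → E} (hf : Orthonormal ℝ f)
    (hg : Orthonormal ℝ g) (hh : Orthonormal ℝ h)
    (hfg : ∀ i j, ∃ m : ℤ, lam * inner ℝ (f i) (g j) = m)
    (hgh : ∀ i j, ∃ m : ℤ, lam * inner ℝ (g i) (h j) = m)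
    (hhf : ∀ i j, ∃ m : ℤ, lam * inner ℝ (h i) (f j) = m) :
    Fintype.card ι + Fintype.card κ + Fintype.card τ ≤ 2 * Module.finrank ℝ E := by
  classical
  choose A hA using hfg
  choose B hB using hgh
  choose D hD using hhf
  set M : Matrix ι ι ℤ := Matrix.of A * Matrix.of B * Matrix.of D with hM
  have hl0 : lam ≠ 0 := hlam.ne_zero
  have hmul : ∀ (c : ι → ℝ) (i : ι), Matrix.toLin' (M.map (Int.cast : ℤ → ℝ)) c i =
      lam ^ 3 * inner ℝ (f i) (famProj g (famProj h (∑ l, c l • f l))) := by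
    intro c i
    have hmap : M.map (Int.cast : ℤ → ℝ) = (Matrix.of A).map (Int.cast : ℤ → ℝ) *
        (Matrix.of B).map (Int.cast : ℤ → ℝ) * (Matrix.of D).map (Int.cast : ℤ → ℝ) := by
      rw [hM]
      ext
      simp [Matrix.mul_apply]
    have h1 : ((Matrix.of D).map (Int.cast : ℤ → ℝ)).mulVec c =
        fun k => lam * inner ℝ (h k) (∑ l, c l • f l) := by
      ext k
      simp only [Matrix.mulVec, dotProduct, Matrix.map_apply, Matrix.of_apply, ← hD, inner_sum,
        inner_smul_right, Finset.mul_sum]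
      exact Finset.sum_congr rfl fun l _ => by ring
    rw [Matrix.toLin'_apply, hmap, ← Matrix.mulVec_mulVec, h1, ← Matrix.mulVec_mulVec,
      mulVec_inner hB, mulVec_inner hA]
    ring
  by_contra hlt
  set U1 := Submodule.span ℝ (Set.range f)
  set U2 := Submodule.span ℝ (Set.range g)
  set U3 := Submodule.span ℝ (Set.range h)
  have hd1 := Submodule.finrank_sup_add_finrank_inf_eq U1 U2
  have hd2 := Submodule.finrank_sup_add_finrank_inf_eq (U1 ⊓ U2) U3
  rw [finrank_span_eq_card hf.linearIndependent, finrank_span_eq_card hg.linearIndependent] at hd1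
  rw [finrank_span_eq_card hh.linearIndependent] at hd2
  have hle1 : Module.finrank ℝ (U1 ⊔ U2 : Submodule ℝ E) ≤ Module.finrank ℝ E :=
    Submodule.finrank_le _
  have hle2 : Module.finrank ℝ (U1 ⊓ U2 ⊔ U3 : Submodule ℝ E) ≤ Module.finrank ℝ E :=
    Submodule.finrank_le _
  have hpos : 0 < Module.finrank ℝ (U1 ⊓ U2 ⊓ U3 : Submodule ℝ E) := by omega
  have hne : (U1 ⊓ U2 ⊓ U3 : Submodule ℝ E) ≠ ⊥ := by
    intro hbot
    rw [hbot, finrank_bot] at hpos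
    exact lt_irrefl _ hpos
  obtain ⟨x, ⟨⟨hx1, hx2⟩, hx3⟩, hx0⟩ := Submodule.exists_mem_ne_zero_of_ne_bot hne
  have hev : Module.End.HasEigenvalue (Matrix.toLin' (M.map (Int.cast : ℤ → ℝ))) (lam ^ 3) := by
    apply Module.End.hasEigenvalue_of_hasEigenvector (x := fun i => inner ℝ (f i) x)
    refine ⟨Module.End.mem_eigenspace_iff.2 ?_, fun h0 => hx0 ?_⟩
    · ext i
      rw [hmul]
      change _ * inner ℝ (f i) (famProj g (famProj h (famProj f x))) = _
      rw [famProj_of_mem hf hx1, famProj_of_mem hh hx3, famProj_of_mem hg hx2]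
      rfl
    · rw [← famProj_of_mem hf hx1, famProj]
      exact Finset.sum_eq_zero fun i _ => by rw [show inner ℝ (f i) x = 0 from congrFun h0 i, zero_smul]
  have hirr : Irrational (lam ^ 3) := by
    have : lam ^ 3 = (N : ℝ) * lam := by rw [← hN]; ring
    rw [this]
    refine hlam.intCast_mul ?_
    rintro rfl
    simp at hN
    exact hl0 hN
  have hev2 := hasEigenvalue_neg M hirr (N := N ^ 3) (by push_cast; rw [← hN]; ring) hev
  obtain ⟨c, hc, hc0⟩ := hev2.exists_hasEigenvector
  rw [Module.End.mem_eigenspace_iff] at hc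
  set y := ∑ l, c l • f l with hy
  have hy1 : famProj f y = y := famProj_of_mem hf
    ((Submodule.mem_span_range_iff_exists_fun ℝ).2 ⟨c, rfl⟩)
  have hcy : ∀ i, c i = inner ℝ (f i) y := fun i => (hf.inner_right_fintype c i).symm
  -- The conjugate eigenvector turns into a vector negated by a product of three projections.
  -- Contractions preserve its norm only by fixing it, so it equals its own negative.
  have hcyc : famProj f (famProj g (famProj h y)) = -y := by
    conv_rhs => rw [hy, ← Finset.sum_neg_distrib]
    rw [famProj]
    refine Finset.sum_congr rfl fun i _ => ?_
    rw [← neg_smul]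
    congr 1
    have := congrFun hc i
    rw [hmul, Pi.smul_apply, smul_eq_mul] at this
    have h3 : lam ^ 3 ≠ 0 := pow_ne_zero 3 hl0
    apply mul_left_cancel₀ h3
    rw [this]; ring
  have hn1 : ‖y‖ ≤ ‖famProj g (famProj h y)‖ := by
    calc ‖y‖ = ‖famProj f (famProj g (famProj h y))‖ := by rw [hcyc, norm_neg]
      _ ≤ _ := norm_famProj_le hf _
  have hn2 : famProj h y = y := famProj_eq_self hh (hn1.trans (norm_famProj_le hg _))
  rw [hn2] at hn1 hcyc
  rw [famProj_eq_self hg hn1, hy1] at hcyc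
  have hy0 : y = 0 := by
    have : (2 : ℝ) • y = 0 := by rw [two_smul]; nth_rewrite 1 [hcyc]; simp
    exact (smul_eq_zero.1 this).resolve_left two_ne_zero
  apply hc0
  ext i
  rw [hcy i, hy0]; simp

/-- If `lam ^ 2` is an integer then `lam` is irrational; otherwise the two-family bounds, summed
cyclically, give the claim. -/
lemma card_add_card_add_card_le {lam : ℝ} (hlam : ¬ ∃ n : ℤ, lam = n)
    {f : ι → E} {g : κ → E} {h : τ → E} (hf : Orthonormal ℝ f)
    (hg : Orthonormal ℝ g) (hh : Orthonormal ℝ h)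
    (hfg : ∀ i j, ∃ m : ℤ, lam * inner ℝ (f i) (g j) = m)
    (hgh : ∀ i j, ∃ m : ℤ, lam * inner ℝ (g i) (h j) = m)
    (hhf : ∀ i j, ∃ m : ℤ, lam * inner ℝ (h i) (f j) = m) :
    Fintype.card ι + Fintype.card κ + Fintype.card τ ≤ 2 * Module.finrank ℝ E := by
  by_cases hN : ∃ n : ℤ, lam ^ 2 = n
  · obtain ⟨N, hN⟩ := hN
    have hirr : Irrational lam := by
      rintro ⟨q, hq⟩
      refine hlam (exists_int_of_isIntegral_rat ?_ hq)
      refine IsIntegral.of_pow (n := 2) (by norm_num) ?_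
      rw [hN]
      exact isIntegral_algebraMap (R := ℤ) (x := N)
    exact card_add_card_add_card_le_of_irrational hirr hN hf hg hh hfg hgh hhf
  · have h1 := card_add_card_le hN hf hg hfg
    have h2 := card_add_card_le hN hg hh hgh
    have h3 := card_add_card_le hN hh hf hhf
    omega

end orthonormal

/-! ### Cliques, their centers and the block decomposition -/

/-- Ramsey's theorem for two colours. -/
lemma exists_ramsey (m n : ℕ) : ∃ N : ℕ, ∀ {α : Type} (r : α → α → Prop),
    (∀ x y, r x y → r y x) → ∀ S : Finset α, N ≤ S.card →
      (∃ T ⊆ S, T.card = m ∧ ∀ x ∈ T, ∀ y ∈ T, x ≠ y → r x y) ∨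
      (∃ T ⊆ S, T.card = n ∧ ∀ x ∈ T, ∀ y ∈ T, x ≠ y → ¬ r x y) := by
  classical
  induction m generalizing n with
  | zero => exact ⟨0, fun r _ S _ => Or.inl ⟨∅, by simp, rfl, by simp⟩⟩
  | succ m ihm =>
    induction n with
    | zero => exact ⟨0, fun r _ S _ => Or.inr ⟨∅, by simp, rfl, by simp⟩⟩
    | succ n ihn =>
      obtain ⟨N1, h1⟩ := ihm (n + 1)
      obtain ⟨N2, h2⟩ := ihn
      refine ⟨N1 + N2 + 1, fun {α} r hr S hS => ?_⟩
      obtain ⟨v, hv⟩ := Finset.card_pos.1 (by omega : 0 < S.card)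
      have hcard := Finset.card_filter_add_card_filter_not (s := S.erase v) (fun x => r v x)
      rw [Finset.card_erase_of_mem hv] at hcard
      have hins : ∀ (P : α → Prop) [DecidablePred P] (T : Finset α), T ⊆ (S.erase v).filter P →
          insert v T ⊆ S ∧ (insert v T).card = T.card + 1 ∧ ∀ x ∈ T, P x := by
        intro P _ T hT
        refine ⟨fun x hx => ?_, card_insert_of_notMem fun hvT => ?_, fun x hx =>
          (mem_filter.1 (hT hx)).2⟩
        · rcases mem_insert.1 hx with rfl | hx
          exacts [hv, mem_of_mem_erase (mem_filter.1 (hT hx)).1]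
        · exact (mem_erase.1 (mem_filter.1 (hT hvT)).1).1 rfl
      by_cases hN1 : N1 ≤ ((S.erase v).filter (fun x => r v x)).card
      · rcases h1 r hr _ hN1 with ⟨T, hTS, hT, hc⟩ | ⟨T, hTS, hT, hc⟩
        · left
          obtain ⟨i1, i2, i3⟩ := hins _ _ hTS
          refine ⟨insert v T, i1, by omega, fun x hx y hy hxy => ?_⟩
          rcases mem_insert.1 hx with rfl | hx' <;> rcases mem_insert.1 hy with rfl | hy'
          exacts [absurd rfl hxy, i3 y hy', hr _ _ (i3 x hx'), hc x hx' y hy' hxy]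
        · exact Or.inr ⟨T, hTS.trans ((filter_subset _ _).trans (erase_subset _ _)), hT, hc⟩
      · rcases h2 r hr ((S.erase v).filter (fun x => ¬ r v x)) (by omega) with
          ⟨T, hTS, hT, hc⟩ | ⟨T, hTS, hT, hc⟩
        · exact Or.inl ⟨T, hTS.trans ((filter_subset _ _).trans (erase_subset _ _)), hT, hc⟩
        · right
          obtain ⟨i1, i2, i3⟩ := hins _ _ hTS
          refine ⟨insert v T, i1, by omega, fun x hx y hy hxy => ?_⟩
          rcases mem_insert.1 hx with rfl | hx' <;> rcases mem_insert.1 hy with rfl | hy'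
          exacts [absurd rfl hxy, i3 y hy', fun h => i3 x hx' (hr _ _ h), hc x hx' y hy' hxy]

/-- A finite spherical code with inner products in `{α} ∪ (-∞, -β]`. -/
structure IsUniacute {E : Type*} [NormedAddCommGroup E] [InnerProductSpace ℝ E] (α β : ℝ)
    (C : Finset E) : Prop where
  norm_eq : ∀ x ∈ C, ‖x‖ = 1
  inner_or : ∀ x ∈ C, ∀ y ∈ C, x ≠ y → inner ℝ x y = α ∨ inner ℝ x y ≤ -β

section vectors
variable {E : Type*} [NormedAddCommGroup E] [InnerProductSpace ℝ E]

/-- For negative `B` the right side turns negative once `S` is large, which bounds the size of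
families with negative inner products. -/
lemma norm_sum_sq_le {ι : Type*} (S : Finset ι) (t : ι → E) {A B : ℝ}
    (hA : ∀ i ∈ S, ‖t i‖ ^ 2 ≤ A) (hB : ∀ i ∈ S, ∀ j ∈ S, i ≠ j → inner ℝ (t i) (t j) ≤ B) :
    ‖∑ i ∈ S, t i‖ ^ 2 ≤ S.card * A + S.card * (S.card - 1) * B := by
  classical
  rw [← real_inner_self_eq_norm_sq, sum_inner]
  have h : ∀ i ∈ S, inner ℝ (t i) (∑ j ∈ S, t j) ≤ A + (S.card - 1) * B := by
    intro i hi
    rw [inner_sum, ← Finset.add_sum_erase S _ hi]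
    have h1 : ∑ j ∈ S.erase i, inner ℝ (t i) (t j) ≤ ∑ _j ∈ S.erase i, B :=
      Finset.sum_le_sum fun j hj => hB i hi j (mem_of_mem_erase hj) (ne_of_mem_erase hj).symm
    rw [Finset.sum_const, card_erase_of_mem hi, nsmul_eq_mul,
      Nat.cast_sub (Finset.card_pos.2 ⟨i, hi⟩)] at h1
    have h2 := hA i hi
    rw [real_inner_self_eq_norm_sq]
    push_cast at h1
    linarith
  refine (Finset.sum_le_sum h).trans (le_of_eq ?_)
  rw [Finset.sum_const, nsmul_eq_mul]
  ring

/-- The average of a finite set of vectors. -/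
noncomputable def center (T : Finset E) : E := (T.card : ℝ)⁻¹ • ∑ x ∈ T, x

lemma inner_center (x : E) (T : Finset E) :
    inner ℝ x (center T) = (T.card : ℝ)⁻¹ * ∑ y ∈ T, inner ℝ x y := by
  rw [center, inner_smul_right, inner_sum]

lemma inner_center_le {x : E} {T : Finset E} (hT : T.Nonempty) {c : ℝ}
    (h : ∀ y ∈ T, inner ℝ x y ≤ c) : inner ℝ x (center T) ≤ c := by
  rw [inner_center, inv_mul_le_iff₀ (by exact_mod_cast hT.card_pos)]
  refine (Finset.sum_le_sum h).trans (le_of_eq ?_)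
  simp

lemma le_inner_center {x : E} {T : Finset E} (hT : T.Nonempty) {c : ℝ}
    (h : ∀ y ∈ T, c ≤ inner ℝ x y) : c ≤ inner ℝ x (center T) := by
  rw [inner_center, le_inv_mul_iff₀ (by exact_mod_cast hT.card_pos)]
  refine le_trans (le_of_eq ?_) (Finset.sum_le_sum h)
  simp

/-- A set of unit vectors with all mutual inner products equal to `α`. -/
def IsAlphaClique (α : ℝ) (T : Finset E) : Prop :=
  (∀ x ∈ T, ‖x‖ = 1) ∧ ∀ x ∈ T, ∀ y ∈ T, x ≠ y → inner ℝ x y = α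

namespace IsAlphaClique
variable {α : ℝ} {T : Finset E}

lemma inner_sum_smul (h : IsAlphaClique α T) (c : E → ℝ) {x : E} (hx : x ∈ T) :
    inner ℝ x (∑ y ∈ T, c y • y) = α * ∑ y ∈ T, c y + (1 - α) * c x := by
  classical
  rw [inner_sum, ← Finset.add_sum_erase T _ hx, ← Finset.add_sum_erase T c hx]
  have h1 : ∑ y ∈ T.erase x, inner ℝ x (c y • y) = α * ∑ y ∈ T.erase x, c y := by
    rw [Finset.mul_sum]
    refine Finset.sum_congr rfl fun y hy => ?_
    rw [inner_smul_right, h.2 x hx y (mem_of_mem_erase hy) (ne_of_mem_erase hy).symm]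
    ring
  rw [h1, inner_smul_right, real_inner_self_eq_norm_sq, h.1 x hx]
  ring

lemma norm_center_sq (h : IsAlphaClique α T) (hT : T.Nonempty) :
    ‖center T‖ ^ 2 = α + (1 - α) / T.card := by
  have hc : (T.card : ℝ) ≠ 0 := by exact_mod_cast hT.card_pos.ne'
  have h1 : ∀ x ∈ T, inner ℝ (center T) x = α + (1 - α) / T.card := by
    intro x hx
    have := h.inner_sum_smul (fun _ => 1) hx
    simp only [one_smul, Finset.sum_const, nsmul_eq_mul, mul_one] at this
    rw [real_inner_comm, center, inner_smul_right, this]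
    field_simp
  rw [← real_inner_self_eq_norm_sq]
  nth_rewrite 2 [center]
  rw [inner_smul_right, inner_sum, Finset.sum_congr rfl h1]
  simp only [Finset.sum_const, nsmul_eq_mul]
  field_simp

/-- Cauchy–Schwarz for `x` and `z = ∑ c y • y`, where `c y` is the deviation from the mean. As these
sum to zero, `⟪x, z⟫ = ∑ (c y)²` and `‖z‖² = (1 - α) ∑ (c y)²`. Thus a center of a large clique acts
almost like a member. -/
lemma sum_sq_le (h : IsAlphaClique α T) (hα : α ≤ 1) (x : E) :
    ∑ y ∈ T, (inner ℝ x y - inner ℝ x (center T)) ^ 2 ≤ (1 - α) * ‖x‖ ^ 2 := by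
  rcases T.eq_empty_or_nonempty with rfl | hT
  · simp only [Finset.sum_empty]
    have : 0 ≤ 1 - α := by linarith
    positivity
  have hc0 : (T.card : ℝ) ≠ 0 := by exact_mod_cast hT.card_pos.ne'
  set c : E → ℝ := fun y => inner ℝ x y - inner ℝ x (center T) with hc
  have hsum : ∑ y ∈ T, c y = 0 := by
    simp only [hc, Finset.sum_sub_distrib, Finset.sum_const, nsmul_eq_mul]
    rw [inner_center]
    field_simp
    ring
  set z := ∑ y ∈ T, c y • y with hz
  set S := ∑ y ∈ T, c y ^ 2 with hS
  have hxz : inner ℝ x z = S := by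
    rw [hz, inner_sum]
    have h1 : ∀ y ∈ T, inner ℝ x (c y • y) = c y ^ 2 + inner ℝ x (center T) * c y := by
      intro y _
      rw [inner_smul_right]
      simp only [hc]; ring
    rw [Finset.sum_congr rfl h1, Finset.sum_add_distrib, ← Finset.mul_sum, hsum]
    ring
  have hzz : ‖z‖ ^ 2 = (1 - α) * S := by
    rw [← real_inner_self_eq_norm_sq]
    nth_rewrite 1 [hz]
    rw [sum_inner, hS, Finset.mul_sum]
    refine Finset.sum_congr rfl fun y hy => ?_
    rw [inner_smul_left, h.inner_sum_smul c hy, hsum]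
    simp; ring
  have hcs : S ^ 2 ≤ ‖x‖ ^ 2 * ((1 - α) * S) := by
    rw [← hzz, ← hxz, ← mul_pow]
    have := abs_real_inner_le_norm x z
    exact sq_le_sq' (by linarith [neg_abs_le (inner ℝ x z)]) (le_trans (le_abs_self _) this)
  have hS0 : 0 ≤ S := Finset.sum_nonneg fun _ _ => sq_nonneg _
  rcases hS0.eq_or_lt with h0 | h0
  · rw [← h0]
    have : 0 ≤ 1 - α := by linarith
    positivity
  · have : S * S ≤ S * ((1 - α) * ‖x‖ ^ 2) := by nlinarith
    exact le_of_mul_le_mul_left this h0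

lemma exists_close (h : IsAlphaClique α T) (hα0 : 0 < α) (hα : α ≤ 1) {η : ℝ} (hη : 0 ≤ η)
    (hT : 1 ≤ T.card * η ^ 2) {x : E} (hx : ‖x‖ ≤ 1) :
    ∃ y ∈ T, |inner ℝ x y - inner ℝ x (center T)| ≤ η := by
  by_contra! hc
  have h1 := h.sum_sq_le hα x
  have h2 : ∑ _y ∈ T, η ^ 2 ≤ ∑ y ∈ T, (inner ℝ x y - inner ℝ x (center T)) ^ 2 := by
    refine Finset.sum_le_sum fun y hy => ?_
    rw [← sq_abs (inner ℝ x y - _)]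
    exact pow_le_pow_left₀ hη (hc y hy).le 2
  rw [Finset.sum_const, nsmul_eq_mul] at h2
  have h3 : ‖x‖ ^ 2 ≤ 1 := pow_le_one₀ (norm_nonneg _) hx
  nlinarith

end IsAlphaClique

lemma IsUniacute.subset {α β : ℝ} {C D : Finset E} (h : IsUniacute α β C) (hD : D ⊆ C) :
    IsUniacute α β D :=
  ⟨fun x hx => h.norm_eq x (hD hx), fun x hx y hy => h.inner_or x (hD hx) y (hD hy)⟩

end vectors

/-- A large uniacute code contains a large clique. -/
lemma exists_card_lt_of_no_clique {α β : ℝ} (hβ : 0 < β) (M : ℕ) :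
    ∃ N : ℕ, ∀ {E : Type} [NormedAddCommGroup E] [InnerProductSpace ℝ E] (C : Finset E),
      IsUniacute α β C → (∀ T ⊆ C, T.card = M → ¬ IsAlphaClique α T) → C.card < N := by
  obtain ⟨n, hn⟩ := exists_nat_gt (1 / β)
  obtain ⟨N, hN⟩ := exists_ramsey M (n + 1)
  refine ⟨N, ?_⟩
  intro E _ _ C hC hno
  by_contra! hle
  rcases hN (fun x y : E => inner ℝ x y = α) (fun x y h => by rwa [real_inner_comm]) C hle with
    ⟨T, hTC, hT, hc⟩ | ⟨T, hTC, hT, hc⟩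
  · exact hno T hTC hT ⟨fun x hx => hC.norm_eq x (hTC hx), hc⟩
  · have h1 := norm_sum_sq_le T (fun x => x) (A := 1) (B := -β)
      (fun x hx => by rw [hC.norm_eq x (hTC hx)]; norm_num)
      (fun x hx y hy hxy => (hC.inner_or x (hTC hx) y (hTC hy) hxy).resolve_left (hc x hx y hy hxy))
    have h2 := sq_nonneg ‖∑ x ∈ T, x‖
    rw [hT] at h1
    push_cast at h1
    rw [div_lt_iff₀ hβ] at hn
    have h3 : (0 : ℝ) < n + 1 := by positivity
    nlinarith

/-- The block structure of uniacute codes. -/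
theorem exists_blocks {α β : ℝ} (hα0 : 0 < α) (hα1 : α < 1) (hβ0 : 0 < β) (hβ1 : β < 1) {p : ℕ}
    (hp : 1 ≤ p) (hpβ : α = (p - 1) * β) :
    ∃ (η : ℝ) (N : ℕ), ∀ {E : Type} [NormedAddCommGroup E] [InnerProductSpace ℝ E] (C : Finset E),
      IsUniacute α β C → ∃ (𝒯 : Finset E) (B : E → Finset E), 𝒯.card ≤ p ∧
        C.card ≤ N + ∑ t ∈ 𝒯, (B t).card ∧
        (∀ t ∈ 𝒯, B t ⊆ C) ∧
        (∀ t ∈ 𝒯, ∀ x ∈ B t, ∀ Z ⊆ B t, (∀ z ∈ Z, z ≠ x ∧ inner ℝ x z ≠ α) → Z.card ≤ N) ∧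
        (∀ t ∈ 𝒯, ∀ x ∈ B t, α - η ≤ inner ℝ x t) ∧
        ∀ s ∈ 𝒯, ∀ t ∈ 𝒯, s ≠ t → ∀ a : E, ‖a‖ ^ 2 = α → α - η ≤ inner ℝ a s →
          ¬ α - η ≤ inner ℝ a t := by
  classical
  have hp0 : (1 : ℝ) ≤ p := by exact_mod_cast hp
  -- The tolerance: `2 p η` must stay well below `β` when counting centers, and `4 η` and `12 η`
  -- below the squared gaps in the comparisons of centers.
  set η : ℝ := β ^ 2 / (100 * p) with hη
  have hη0 : 0 < η := by positivity
  have hpη : 100 * (p * η) = β ^ 2 := by rw [hη]; field_simp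
  have hηle : 100 * η ≤ β ^ 2 := by nlinarith
  have hββ : β ^ 2 < β := by nlinarith
  obtain ⟨M, hM⟩ := exists_nat_gt (1 / η ^ 2)
  have hM2 : 1 ≤ M * η ^ 2 := by
    rw [div_lt_iff₀ (by positivity)] at hM
    exact hM.le
  have hM0 : 0 < M := by
    rcases Nat.eq_zero_or_pos M with rfl | h
    · norm_num at hM2
    · exact h
  obtain ⟨N, hN⟩ := exists_card_lt_of_no_clique (α := α) hβ0 M
  refine ⟨η, N, ?_⟩
  intro E _ _ C hC
  set Z : Finset E := (C.powerset.filter (fun T => T.card = M ∧ IsAlphaClique α T)).image center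
    with hZ
  have hZmem : ∀ t ∈ Z, ∃ T ⊆ C, T.card = M ∧ IsAlphaClique α T ∧ center T = t := by
    intro t ht
    obtain ⟨T, hT, rfl⟩ := mem_image.1 ht
    obtain ⟨hT1, hT2, hT3⟩ := mem_filter.1 hT
    exact ⟨T, mem_powerset.1 hT1, hT2, hT3, rfl⟩
  have hnormC : ∀ T : Finset E, T.card = M → IsAlphaClique α T →
      α ≤ ‖center T‖ ^ 2 ∧ ‖center T‖ ^ 2 ≤ α + η ^ 2 ∧ ‖center T‖ ≤ 1 := by
    intro T hT hc
    have hM1 : (1 : ℝ) ≤ M := by exact_mod_cast hM0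
    have h1 := hc.norm_center_sq (Finset.card_pos.1 (by omega))
    rw [hT] at h1
    have h2 : 0 ≤ (1 - α) / M := div_nonneg (by linarith) (by positivity)
    have h3 : (1 - α) / M ≤ η ^ 2 := by
      rw [div_le_iff₀ (by positivity)]; nlinarith
    have h4 : (1 - α) / M ≤ 1 - α := div_le_self (by linarith) hM1
    refine ⟨by linarith, by linarith, ?_⟩
    have h5 : ‖center T‖ ^ 2 ≤ 1 ^ 2 := by rw [h1]; linarith
    exact le_of_sq_le_sq h5 zero_le_one
  have hdich : ∀ T ⊆ C, T.card = M → IsAlphaClique α T → ∀ x ∈ C,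
      α - η ≤ inner ℝ x (center T) ∨ inner ℝ x (center T) ≤ -β + η := by
    intro T hTC hT hc x hx
    obtain ⟨y, hy, hxy⟩ := hc.exists_close hα0 hα1.le hη0.le (by rw [hT]; exact hM2)
      (hC.norm_eq x hx).le
    rw [abs_le] at hxy
    by_cases hne : x = y
    · left
      subst hne
      have : inner ℝ x x = (1 : ℝ) := by
        rw [real_inner_self_eq_norm_sq, hC.norm_eq x hx]; norm_num
      linarith
    · rcases hC.inner_or x hx y (hTC hy) hne with h | h
      · left; linarith
      · right; linarith
  -- A largest family of separated clique centers. Points near none of them contain no `M`-clique,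
  -- as its center could be added to the family.
  obtain ⟨𝒯, h𝒯, hmax⟩ := Finset.exists_max_image
    (Z.powerset.filter (fun 𝒯 => ∀ s ∈ 𝒯, ∀ t ∈ 𝒯, s ≠ t → inner ℝ s t ≤ -β + 2 * η))
    Finset.card ⟨∅, by simp⟩
  obtain ⟨h𝒯Z, hsep⟩ := mem_filter.1 h𝒯
  rw [mem_powerset] at h𝒯Z
  set W : Finset E := C.filter (fun x => ∀ t ∈ 𝒯, ¬ α - η ≤ inner ℝ x t) with hW
  set B : E → Finset E := fun t => C.filter (fun x => α - η ≤ inner ℝ x t) with hB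
  refine ⟨𝒯, B, ?_, ?_, fun t _ => filter_subset _ _, ?_, fun t _ x hx => (mem_filter.1 hx).2, ?_⟩
  · by_contra! hlt
    obtain ⟨S, hS𝒯, hS⟩ := Finset.exists_subset_card_eq (Nat.succ_le_of_lt hlt)
    have h1 := norm_sum_sq_le S (fun x => x) (A := α + η ^ 2) (B := -β + 2 * η)
      (fun t ht => by
        obtain ⟨T, _, hT, hc, rfl⟩ := hZmem t (h𝒯Z (hS𝒯 ht))
        exact (hnormC T hT hc).2.1)
      (fun s hs t ht => hsep s (hS𝒯 hs) t (hS𝒯 ht))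
    have h2 := sq_nonneg ‖∑ x ∈ S, x‖
    rw [hS] at h1
    push_cast at h1
    have h3 : (p + 1 : ℝ) * (α + η ^ 2) + (p + 1) * (p + 1 - 1) * (-β + 2 * η) =
        (p + 1) * (-β + η ^ 2 + 2 * (p * η)) := by rw [hpβ]; ring
    have h4 : -β + η ^ 2 + 2 * (p * η) < 0 := by nlinarith
    have h5 : (0 : ℝ) < p + 1 := by positivity
    nlinarith
  · have hWcard : W.card < N := by
      refine hN W (hC.subset (filter_subset _ _)) fun T hTW hT hc => ?_
      have hTC : T ⊆ C := hTW.trans (filter_subset _ _)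
      have hTne : T.Nonempty := Finset.card_pos.1 (by omega)
      have hle : ∀ t ∈ 𝒯, inner ℝ t (center T) ≤ -β + η := by
        intro t ht
        refine inner_center_le hTne fun x hx => ?_
        obtain ⟨T', hT'C, hT', hc', rfl⟩ := hZmem t (h𝒯Z ht)
        rw [real_inner_comm]
        exact (hdich T' hT'C hT' hc' x (hTC hx)).resolve_left ((mem_filter.1 (hTW hx)).2 _ ht)
      have hnot : center T ∉ 𝒯 := by
        intro hmem
        have h1 := hle _ hmem
        rw [real_inner_self_eq_norm_sq] at h1
        have := (hnormC T hT hc).1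
        nlinarith
      have := hmax (insert (center T) 𝒯) (mem_filter.2 ⟨mem_powerset.2 ?_, ?_⟩)
      · rw [card_insert_of_notMem hnot] at this
        omega
      · intro t ht
        rcases mem_insert.1 ht with rfl | ht
        · exact mem_image.2 ⟨T, mem_filter.2 ⟨mem_powerset.2 hTC, hT, hc⟩, rfl⟩
        · exact h𝒯Z ht
      · intro s hs t ht hst
        rcases mem_insert.1 hs with rfl | hs' <;> rcases mem_insert.1 ht with rfl | ht'
        · exact absurd rfl hst
        · rw [real_inner_comm]; linarith [hle t ht']
        · linarith [hle s hs']
        · exact hsep s hs' t ht' hst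
    have hsub : C ⊆ W ∪ 𝒯.biUnion B := by
      intro x hx
      by_cases h : ∀ t ∈ 𝒯, ¬ α - η ≤ inner ℝ x t
      · exact mem_union_left _ (mem_filter.2 ⟨hx, h⟩)
      · push Not at h
        obtain ⟨t, ht, htx⟩ := h
        exact mem_union_right _ (mem_biUnion.2 ⟨t, ht, mem_filter.2 ⟨hx, htx⟩⟩)
    calc C.card ≤ (W ∪ 𝒯.biUnion B).card := card_le_card hsub
      _ ≤ W.card + (𝒯.biUnion B).card := card_union_le _ _
      _ ≤ N + ∑ t ∈ 𝒯, (B t).card := Nat.add_le_add hWcard.le card_biUnion_le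
  -- A clique among the partners of `x` would have its center close to `t`, yet `x` has inner
  -- product about `α` with `t` and at most `-β` with that center.
  · intro t ht x hx Y hYB hY
    refine (hN Y (hC.subset (hYB.trans (filter_subset _ _))) fun T hTY hT hc => ?_).le
    have hTne : T.Nonempty := Finset.card_pos.1 (by omega)
    obtain ⟨hxC, hxt⟩ := mem_filter.1 hx
    have h1 : inner ℝ x (center T) ≤ -β := by
      refine inner_center_le hTne fun y hy => ?_
      obtain ⟨hyx, hne⟩ := hY y (hTY hy)
      exact (hC.inner_or x hxC y (mem_filter.1 (hYB (hTY hy))).1 hyx.symm).resolve_left hne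
    have h2 : α - η ≤ inner ℝ t (center T) := by
      refine le_inner_center hTne fun y hy => ?_
      rw [real_inner_comm]
      exact (mem_filter.1 (hYB (hTY hy))).2
    obtain ⟨T', -, hT', hc', rfl⟩ := hZmem t (h𝒯Z ht)
    have h3 := (hnormC T hT hc).2.1
    have h4 := (hnormC T' hT' hc').2.1
    have h5 : ‖center T' - center T‖ ^ 2 ≤ 4 * η := by
      rw [norm_sub_sq_real]
      nlinarith
    have h6 : α + β - η ≤ inner ℝ x (center T' - center T) := by
      rw [inner_sub_right]; linarith
    have h7 := real_inner_le_norm x (center T' - center T)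
    rw [hC.norm_eq x hxC, one_mul] at h7
    have h8 : (α + β - η) ^ 2 ≤ 4 * η :=
      (pow_le_pow_left₀ (by nlinarith) (h6.trans h7) 2).trans h5
    nlinarith
  -- A vector of squared norm `α` that is close to both `s` and `t` would bring them close to each
  -- other, against separation.
  · intro s hs t ht hst a ha has hat
    have h0 := hsep s hs t ht hst
    obtain ⟨T, -, hT, hc, rfl⟩ := hZmem t (h𝒯Z ht)
    obtain ⟨T', -, hT', hc', rfl⟩ := hZmem s (h𝒯Z hs)
    obtain ⟨h1, h2, -⟩ := hnormC T hT hc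
    obtain ⟨h3, h4, -⟩ := hnormC T' hT' hc'
    have h5 : ‖center T' - a‖ ^ 2 ≤ 3 * η := by
      rw [norm_sub_sq_real, real_inner_comm]
      nlinarith
    have h6 : ‖a - center T‖ ^ 2 ≤ 3 * η := by
      rw [norm_sub_sq_real]
      nlinarith
    have h7 : ‖center T' - center T‖ ^ 2 ≤ 12 * η := by
      have h8 : ‖center T' - center T‖ ≤ ‖center T' - a‖ + ‖a - center T‖ := norm_sub_le_norm_sub_add_norm_sub _ _ _
      have h9 := pow_le_pow_left₀ (norm_nonneg _) h8 2
      nlinarith [sq_nonneg (‖center T' - a‖ - ‖a - center T‖)]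
    rw [norm_sub_sq_real] at h7
    nlinarith

/-! ### The graph of a block and its antipodal pairs -/

section pairs
variable {E : Type} [NormedAddCommGroup E] [InnerProductSpace ℝ E]

/-- Antipodal pairs `a ± y i` in `B`, where the vectors `y i` are mutually orthogonal and orthogonal
to `a`. -/
structure IsPairSystem {ι : Type*} (α : ℝ) (B : Finset E) (a : E) (y : ι → E) : Prop where
  norm_center : ‖a‖ ^ 2 = α
  inner_center : ∀ i, inner ℝ a (y i) = 0
  norm_sq : ∀ i, ‖y i‖ ^ 2 = 1 - α
  inner_eq_zero : ∀ i j, i ≠ j → inner ℝ (y i) (y j) = 0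
  add_mem : ∀ i, a + y i ∈ B
  sub_mem : ∀ i, a - y i ∈ B

/-- The weighted graph of a block. -/
noncomputable def blockGraph (α β : ℝ) (B : Finset E) (u v : B) : ℝ :=
  open Classical in if u = v then 0 else (α - inner ℝ (u : E) (v : E)) / (α + β)

variable {α β : ℝ} {B : Finset E}

lemma blockGraph_of_ne {u v : B} (h : u ≠ v) :
    blockGraph α β B u v = (α - inner ℝ (u : E) (v : E)) / (α + β) := by
  simp [blockGraph, h]

lemma inner_of_blockGraph (hαβ : 0 < α + β) {u v : B} (h : u ≠ v) :
    inner ℝ (u : E) (v : E) = α - (α + β) * blockGraph α β B u v := by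
  rw [blockGraph_of_ne h]
  field_simp
  ring

lemma isWeightedGraph_blockGraph (hα0 : 0 < α) (hα1 : α < 1) (hβ0 : 0 < β)
    (hB : IsUniacute α β B) {N R : ℕ} (hR : N * (2 / (α + β)) ≤ R)
    (hdeg : ∀ x ∈ B, ∀ Z ⊆ B, (∀ z ∈ Z, z ≠ x ∧ inner ℝ x z ≠ α) → Z.card ≤ N) :
    IsWeightedGraph (blockGraph α β B) R := by
  classical
  have hαβ : 0 < α + β := by linarith
  have hor : ∀ u v, blockGraph α β B u v = 0 ∨ 1 ≤ blockGraph α β B u v := by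
    intro u v
    by_cases h : u = v
    · left; simp [blockGraph, h]
    · rw [blockGraph_of_ne h]
      rcases hB.inner_or u u.2 v v.2 (fun h' => h (Subtype.ext h')) with h1 | h1
      · left; rw [h1]; simp
      · right; rw [le_div_iff₀ hαβ]; linarith
  refine ⟨fun u v => ?_, fun u => by simp [blockGraph], hor, fun u => ?_⟩
  · by_cases h : u = v
    · rw [h]
    · rw [blockGraph_of_ne h, blockGraph_of_ne (Ne.symm h), real_inner_comm]
  · refine le_trans ?_ hR
    have h1 : ∀ v, blockGraph α β B u v ≤ if blockGraph α β B u v ≠ 0 then 2 / (α + β) else 0 := by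
      intro v
      split_ifs with h0
      · have hne : u ≠ v := by rintro rfl; exact h0 (by simp [blockGraph])
        rw [blockGraph_of_ne hne]
        have := abs_real_inner_le_norm (u : E) (v : E)
        rw [hB.norm_eq u u.2, hB.norm_eq v v.2, abs_le] at this
        gcongr
        linarith
      · push Not at h0; exact h0.le
    refine (Finset.sum_le_sum fun v _ => h1 v).trans ?_
    rw [← Finset.sum_filter, Finset.sum_const, nsmul_eq_mul]
    refine mul_le_mul_of_nonneg_right ?_ (by positivity)
    norm_cast
    rw [← Finset.card_map (Function.Embedding.subtype (fun x => x ∈ B))]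
    refine hdeg u u.2 _ (fun z hz => ?_) fun z hz => ?_
    · obtain ⟨w, -, rfl⟩ := mem_map.1 hz
      exact w.2
    · obtain ⟨w, hw, rfl⟩ := mem_map.1 hz
      have hw := (mem_filter.1 hw).2
      have hne : u ≠ w := by rintro rfl; exact hw (by simp [blockGraph])
      refine ⟨fun h => hne (Subtype.ext h.symm), fun h => hw ?_⟩
      rw [blockGraph_of_ne hne]
      change inner ℝ (u : E) (w : E) = α at h
      rw [h]; simp

/-- The Gram matrix is `α J + (1 - α) I - (α + β) X`, so `lam - X` is the Gram matrix minus `α J`,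
divided by `α + β`. -/
lemma shiftOp_blockGraph (hαβ : 0 < α + β) (hB : IsUniacute α β B) (w : B → ℝ) (u : B) :
    shiftOp (blockGraph α β B) ((1 - α) / (α + β)) w u =
      (inner ℝ (u : E) (∑ v, w v • (v : E)) - α * ∑ v, w v) / (α + β) := by
  classical
  rw [shiftOp, ← Finset.add_sum_erase univ _ (mem_univ u), inner_sum,
    ← Finset.add_sum_erase univ (fun v => inner ℝ (u : E) (w v • (v : E))) (mem_univ u),
    ← Finset.add_sum_erase univ w (mem_univ u)]
  have h1 : ∑ v ∈ univ.erase u, blockGraph α β B u v * w v =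
      (α * ∑ v ∈ univ.erase u, w v - ∑ v ∈ univ.erase u, inner ℝ (u : E) (w v • (v : E))) /
        (α + β) := by
    rw [Finset.mul_sum, ← Finset.sum_sub_distrib, Finset.sum_div]
    refine Finset.sum_congr rfl fun v hv => ?_
    rw [blockGraph_of_ne (ne_of_mem_erase hv).symm, inner_smul_right]
    field_simp
  rw [h1, inner_smul_right, real_inner_self_eq_norm_sq, hB.norm_eq u u.2]
  simp only [blockGraph, if_true]
  field_simp
  ring

lemma shiftForm_blockGraph_nonneg (hαβ : 0 < α + β) (hB : IsUniacute α β B) (w : B → ℝ)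
    (hw : ∑ u, w u = 0) : 0 ≤ shiftForm (blockGraph α β B) ((1 - α) / (α + β)) w := by
  have h : shiftForm (blockGraph α β B) ((1 - α) / (α + β)) w =
      ‖∑ v, w v • (v : E)‖ ^ 2 / (α + β) := by
    rw [← real_inner_self_eq_norm_sq]
    conv_rhs => rw [sum_inner, Finset.sum_div]
    refine Finset.sum_congr rfl fun u _ => ?_
    rw [shiftOp_blockGraph hαβ hB, hw, inner_smul_left]
    simp
    ring
  rw [h]
  positivity

/-- An edge of weight `lam` means inner product `2 α - 1`, and points of different pairs have inner
product `α`. All pair sums thus have squared norm `4 α` and mutual inner products `4 α`, so they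
coincide: the pairs share their midpoint `a`, and the half-differences are the `y`. -/
lemma isPairSystem_of_perfect (hα0 : 0 < α) (hα1 : α < 1) (hβ0 : 0 < β)
    (hB : IsUniacute α β B) {T : Finset B} (hTne : T.Nonempty)
    (hT : ∀ u ∈ T, ∃ v, v ∉ T ∧ IsPerfectPair (blockGraph α β B) ((1 - α) / (α + β)) u v) :
    ∃ (a : E) (y : T → E), IsPairSystem α B a y := by
  have hαβ : 0 < α + β := by linarith
  have hsymm : ∀ u v, blockGraph α β B u v = blockGraph α β B v u := by
    intro u v
    by_cases h : u = v
    · rw [h]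
    · rw [blockGraph_of_ne h, blockGraph_of_ne (Ne.symm h), real_inner_comm]
  have hlam : 0 < (1 - α) / (α + β) := div_pos (by linarith) hαβ
  choose σ hσT hσ using fun u : T => hT u u.2
  have hone : ∀ u : B, inner ℝ (u : E) (u : E) = (1 : ℝ) := by
    intro u; rw [real_inner_self_eq_norm_sq, hB.norm_eq u u.2]; norm_num
  have hne : ∀ u w : T, (u : B) ≠ σ w := fun u w h => hσT w (h ▸ u.2)
  have hpair : ∀ u : T, inner ℝ ((u : B) : E) (σ u : E) = 2 * α - 1 := by
    intro u
    rw [inner_of_blockGraph hαβ (hne u u), (hσ u).1]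
    field_simp
    ring
  have hzero : ∀ u w : B, u ≠ w → blockGraph α β B u w = 0 → inner ℝ (u : E) (w : E) = α := by
    intro u w h h0
    rw [inner_of_blockGraph hαβ h, h0]; ring
  have hσinj : ∀ u w : T, u ≠ w → σ u ≠ σ w := by
    intro u w huw h
    apply huw
    apply Subtype.ext
    have h1 := (hσ u).symm hsymm
    have h2 := (hσ w).symm hsymm
    rw [h] at h1
    exact h1.unique hlam h2
  have h11 : ∀ u w : T, u ≠ w → inner ℝ ((u : B) : E) ((w : B) : E) = α := fun u w h =>
    hzero _ _ (fun h' => h (Subtype.ext h')) ((hσ u).2.1 _ (hne w u))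
  have h12 : ∀ u w : T, u ≠ w → inner ℝ ((u : B) : E) (σ w : E) = α := fun u w h =>
    hzero _ _ (hne u w) ((hσ u).2.1 _ (hσinj w u h.symm))
  have h22 : ∀ u w : T, u ≠ w → inner ℝ (σ u : E) (σ w : E) = α := fun u w h =>
    hzero _ _ (hσinj u w h) ((hσ u).2.2 _ (hne u w).symm)
  obtain ⟨u0', hu0⟩ := hTne
  set u0 : T := ⟨u0', hu0⟩
  have hz : ∀ u : T, ((u : B) : E) + σ u = (u0 : B) + σ u0 := by
    intro u
    by_cases h : u = u0
    · rw [h]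
    · rw [← sub_eq_zero, ← norm_eq_zero, ← pow_eq_zero_iff two_ne_zero,
        ← real_inner_self_eq_norm_sq]
      have e1 := h11 u u0 h
      have e2 := h12 u u0 h
      have e3 := h12 u0 u (Ne.symm h)
      have e4 := h22 u u0 h
      have e5 := hpair u
      have e6 := hpair u0
      have e7 := hone u
      have e8 := hone u0
      have e9 := hone (σ u)
      have e10 := hone (σ u0)
      simp only [inner_sub_left, inner_sub_right, inner_add_left, inner_add_right]
      rw [real_inner_comm ((u : B) : E) (σ u : E), real_inner_comm ((u0 : B) : E) (σ u0 : E),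
        real_inner_comm ((u : B) : E) ((u0 : B) : E), real_inner_comm ((u : B) : E) (σ u0 : E),
        real_inner_comm (σ u : E) (σ u0 : E), real_inner_comm ((u0 : B) : E) (σ u : E)]
      linarith
  have hcomm := fun u : T => real_inner_comm ((u : B) : E) (σ u : E)
  set a : E := (2 : ℝ)⁻¹ • (((u0 : B) : E) + σ u0) with ha
  have hau : ∀ u : T, a = (2 : ℝ)⁻¹ • (((u : B) : E) + σ u) := fun u => by rw [hz u]
  refine ⟨a, fun u => (2 : ℝ)⁻¹ • (((u : B) : E) - σ u), ?_, fun u => ?_, fun u => ?_,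
    fun u w h => ?_, fun u => ?_, fun u => ?_⟩
  · rw [← real_inner_self_eq_norm_sq, ha]
    simp only [inner_smul_left, inner_smul_right, inner_add_left, inner_add_right, hone, hpair,
      hcomm, RCLike.conj_to_real]
    ring
  · rw [hau u]
    simp only [inner_smul_left, inner_smul_right, inner_add_left, inner_sub_right, hone, hpair,
      hcomm, RCLike.conj_to_real]
    ring
  · rw [← real_inner_self_eq_norm_sq]
    simp only [inner_smul_left, inner_smul_right, inner_sub_left, inner_sub_right, hone, hpair,
      hcomm, RCLike.conj_to_real]
    ring
  · simp only [inner_smul_left, inner_smul_right, inner_sub_left, inner_sub_right, h11 u w h,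
      h12 u w h, h22 u w h, RCLike.conj_to_real]
    rw [real_inner_comm, h12 w u h.symm]
    ring
  · have : a + (2 : ℝ)⁻¹ • (((u : B) : E) - σ u) = (u : B) := by
      rw [hau u, ← smul_add, add_add_sub_cancel, ← two_smul ℝ, smul_smul]
      norm_num
    simp only [this]
    exact u.1.2
  · have : a - (2 : ℝ)⁻¹ • (((u : B) : E) - σ u) = σ u := by
      rw [hau u, ← smul_sub, add_sub_sub_cancel, ← two_smul ℝ, smul_smul]
      norm_num
    simp only [this]
    exact (σ u).2

end pairs

/-- The size of a block is controlled by the dimension and the number of its antipodal pairs. -/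
theorem exists_card_block_le {α β : ℝ} (hα0 : 0 < α) (hα1 : α < 1) (hβ0 : 0 < β) (N : ℕ) :
    ∃ K : ℝ, ∀ {E : Type} [NormedAddCommGroup E] [InnerProductSpace ℝ E] [FiniteDimensional ℝ E]
      (B : Finset E), IsUniacute α β B →
      (∀ x ∈ B, ∀ Z ⊆ B, (∀ z ∈ Z, z ≠ x ∧ inner ℝ x z ≠ α) → Z.card ≤ N) →
      ∃ ρ : ℕ, (B.card : ℝ) ≤ 3 / 2 * Module.finrank ℝ E + ρ / 2 + K ∧
        (0 < ρ → ∃ (a : E) (y : Fin ρ → E), IsPairSystem α B a y) := by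
  classical
  have hαβ : 0 < α + β := by linarith
  have hlam : 0 < (1 - α) / (α + β) := div_pos (by linarith) hαβ
  obtain ⟨R, hR⟩ := exists_nat_ge (N * (2 / (α + β)) + 1)
  have hR1 : 1 ≤ R := by
    have h1 : (0 : ℝ) ≤ N * (2 / (α + β)) := by positivity
    have : (1 : ℝ) ≤ R := by linarith
    exact_mod_cast this
  obtain ⟨K, hK⟩ := exists_finrank_eigenspace_le ((1 - α) / (α + β)) hlam R hR1
  refine ⟨3 / 2 * (K + 1), ?_⟩
  intro E _ _ _ B hB hdeg
  have hG := isWeightedGraph_blockGraph hα0 hα1 hβ0 hB (R := R) (by linarith) hdeg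
  obtain ⟨T, hT, hTpair, -⟩ := exists_perfect_reps hG hlam
  -- Recording the coefficient sum besides the linear combination costs one dimension and makes
  -- every kernel vector an eigenvector for `lam`.
  set f : (B → ℝ) →ₗ[ℝ] E × ℝ :=
    (∑ v : B, (LinearMap.proj v : (B → ℝ) →ₗ[ℝ] ℝ).smulRight (v : E)).prod
      (∑ v : B, (LinearMap.proj v : (B → ℝ) →ₗ[ℝ] ℝ)) with hf
  have hker : ∀ k ∈ LinearMap.ker f, ∀ u, ∑ v, blockGraph α β B u v * k v =
      (1 - α) / (α + β) * k u := by
    intro k hk u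
    rw [LinearMap.mem_ker, Prod.ext_iff] at hk
    have h1 : ∑ v, k v • (v : E) = 0 := by
      rw [← show (f k).1 = (0 : E) from hk.1]
      change _ = (∑ v : B, (LinearMap.proj v : (B → ℝ) →ₗ[ℝ] ℝ).smulRight (v : E)) k
      rw [LinearMap.sum_apply]
      rfl
    have h2 : ∑ v, k v = 0 := by
      rw [← show (f k).2 = (0 : ℝ) from hk.2]
      change _ = (∑ v : B, (LinearMap.proj v : (B → ℝ) →ₗ[ℝ] ℝ)) k
      rw [LinearMap.sum_apply]
      rfl
    have h3 := shiftOp_blockGraph hαβ hB k u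
    rw [h1, h2, shiftOp, inner_zero_right, mul_zero, sub_zero, zero_div] at h3
    linarith
  have hdim := LinearMap.finrank_range_add_finrank_ker f
  have hle : Module.finrank ℝ (LinearMap.range f) ≤ Module.finrank ℝ E + 1 := by
    refine (Submodule.finrank_le _).trans ?_
    rw [Module.finrank_prod, Module.finrank_self]
  rw [Module.finrank_fintype_fun_eq_card] at hdim
  have hmain := hK hG (shiftForm_blockGraph_nonneg hαβ hB) (LinearMap.ker f) hker T.card hT
  refine ⟨T.card, ?_, fun hpos => ?_⟩
  · have h1 : (Fintype.card B : ℝ) ≤ Module.finrank ℝ E + 1 +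
        Module.finrank ℝ (LinearMap.ker f) := by
      rw [← hdim]; push_cast
      have : (Module.finrank ℝ (LinearMap.range f) : ℝ) ≤ Module.finrank ℝ E + 1 := by
        exact_mod_cast hle
      linarith
    rw [Fintype.card_coe] at h1 hmain
    linarith
  · obtain ⟨a, y, hy⟩ := isPairSystem_of_perfect hα0 hα1 hβ0 hB (card_pos.1 hpos) hTpair
    set e := T.equivFin
    exact ⟨a, fun i => y (e.symm i), hy.norm_center, fun i => hy.inner_center _,
      fun i => hy.norm_sq _, fun i j hij => hy.inner_eq_zero _ _ (fun h => hij (e.symm.injective h)),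
      fun i => hy.add_mem _, fun i => hy.sub_mem _⟩

/-! ### Interaction of pair systems in different blocks -/

section cross
variable {E : Type} [NormedAddCommGroup E] [InnerProductSpace ℝ E] {α β : ℝ}

namespace IsPairSystem
variable {ι : Type*} {B C : Finset E} {a : E} {y : ι → E}

lemma mono (h : IsPairSystem α B a y) (hBC : B ⊆ C) : IsPairSystem α C a y :=
  ⟨h.norm_center, h.inner_center, h.norm_sq, h.inner_eq_zero, fun i => hBC (h.add_mem i),
    fun i => hBC (h.sub_mem i)⟩

lemma orthonormal (h : IsPairSystem α B a y) (hα1 : α < 1) :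
    Orthonormal ℝ fun i => (√(1 - α))⁻¹ • y i := by
  have hpos : 0 < 1 - α := by linarith
  refine ⟨fun i => ?_, fun i j hij => ?_⟩
  · have h1 : ‖y i‖ = √(1 - α) := by
      rw [← h.norm_sq i, Real.sqrt_sq (norm_nonneg _)]
    rw [norm_smul, h1, norm_inv, Real.norm_of_nonneg (Real.sqrt_nonneg _)]
    exact inv_mul_cancel₀ (Real.sqrt_pos.2 hpos).ne'
  · simp only [inner_smul_left, inner_smul_right, h.inner_eq_zero i j hij, mul_zero]

/-- Bessel's inequality, weakened from `1 - α` to `1`. All but boundedly many `y i` are thus almost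
orthogonal to a given `x`. -/
lemma sum_sq_le (h : IsPairSystem α B a y) (hα0 : 0 < α) (hα1 : α < 1) {x : E} (hx : ‖x‖ ≤ 1)
    (S : Finset ι) : ∑ i ∈ S, inner ℝ x (y i) ^ 2 ≤ 1 := by
  have hpos : 0 < 1 - α := by linarith
  have h1 := (h.orthonormal hα1).sum_inner_products_le x (s := S)
  have h2 : ∀ i, ‖inner ℝ ((√(1 - α))⁻¹ • y i) x‖ ^ 2 = (1 - α)⁻¹ * inner ℝ x (y i) ^ 2 := by
    intro i
    rw [inner_smul_left, Real.norm_eq_abs, sq_abs, real_inner_comm, mul_pow]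
    simp [Real.sq_sqrt hpos.le]
  simp only [h2, ← Finset.mul_sum] at h1
  rw [inv_mul_le_iff₀ hpos] at h1
  have h3 : ‖x‖ ^ 2 ≤ 1 := pow_le_one₀ (norm_nonneg _) hx
  nlinarith

lemma card_mul_sq_le (h : IsPairSystem α B a y) (hα0 : 0 < α) (hα1 : α < 1) {x : E}
    (hx : ‖x‖ ≤ 1) {δ : ℝ} (hδ : 0 ≤ δ) (S : Finset ι) (hS : ∀ i ∈ S, δ ≤ |inner ℝ x (y i)|) :
    S.card * δ ^ 2 ≤ 1 := by
  refine le_trans ?_ (h.sum_sq_le hα0 hα1 hx S)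
  rw [← nsmul_eq_mul, ← Finset.sum_const]
  refine Finset.sum_le_sum fun i hi => ?_
  rw [← sq_abs (inner ℝ x (y i))]
  exact pow_le_pow_left₀ hδ (hS i hi) 2

lemma norm_center_le (h : IsPairSystem α B a y) (hα1 : α < 1) : ‖a‖ ≤ 1 := by
  refine le_of_sq_le_sq ?_ zero_le_one
  rw [h.norm_center]
  linarith

/-- A vector whose inner products with a large pair system lie in `{α} ∪ (-∞, -β]` has its inner
product with the centre in the same set. -/
lemma inner_center_or [Fintype ι] (h : IsPairSystem α B a y) (hα0 : 0 < α) (hα1 : α < 1)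
    {x : E} (hx : ‖x‖ ≤ 1) {δ : ℝ} (hδ : 0 < δ) (hδ2 : 2 * δ ≤ α + β)
    (hcard : 1 < Fintype.card ι * δ ^ 2)
    (hL : ∀ i, |inner ℝ x (y i)| < δ → (inner ℝ x (a + y i) = α ∨ inner ℝ x (a + y i) ≤ -β) ∧
      (inner ℝ x (a - y i) = α ∨ inner ℝ x (a - y i) ≤ -β)) :
    inner ℝ x a = α ∨ inner ℝ x a ≤ -β := by
  have hex : ∃ i, |inner ℝ x (y i)| < δ := by
    by_contra! hc
    have := h.card_mul_sq_le hα0 hα1 hx hδ.le univ fun i _ => hc i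
    rw [Finset.card_univ] at this
    linarith
  -- The two inner products differ by less than `2 δ ≤ α + β`, so they lie on the same side of the
  -- gap, and their mean is the inner product with `a`.
  obtain ⟨i, hi⟩ := hex
  obtain ⟨h1, h2⟩ := hL i hi
  rw [inner_add_right] at h1
  rw [inner_sub_right] at h2
  rw [abs_lt] at hi
  rcases h1 with h1 | h1 <;> rcases h2 with h2 | h2
  · left; linarith
  · exfalso; linarith
  · exfalso; linarith
  · right; linarith

/-- The bound `δ ≤ 1 - α` rules out that `x` is itself one of the points `a ± y i` used, where the
code condition would say nothing. -/
lemma mem_inner_center_or [Fintype ι] (h : IsPairSystem α C a y) (hC : IsUniacute α β C)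
    (hα0 : 0 < α) (hα1 : α < 1) {δ : ℝ} (hδ : 0 < δ) (hδ2 : 2 * δ ≤ α + β) (hδ1 : δ ≤ 1 - α)
    (hcard : 1 < Fintype.card ι * δ ^ 2) {x : E} (hx : x ∈ C) :
    inner ℝ x a = α ∨ inner ℝ x a ≤ -β := by
  refine h.inner_center_or hα0 hα1 (hC.norm_eq x hx).le hδ hδ2 hcard fun i hi => ⟨?_, ?_⟩
  · refine hC.inner_or x hx _ (h.add_mem i) ?_
    rintro rfl
    rw [inner_add_left, h.inner_center, real_inner_self_eq_norm_sq, h.norm_sq, abs_lt] at hi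
    linarith
  · refine hC.inner_or x hx _ (h.sub_mem i) ?_
    rintro rfl
    rw [inner_sub_left, h.inner_center, real_inner_self_eq_norm_sq, h.norm_sq, abs_lt] at hi
    linarith

end IsPairSystem

/-- If `p` vectors of squared norm `(p - 1) β` have mutual inner products at most `-β`, then they
sum to zero and these inner products equal `-β`. -/
lemma inner_eq_of_card_eq {ι : Type*} {S : Finset ι} {t : ι → E} {p : ℕ} (hp : S.card = p)
    (hpβ : α = (p - 1) * β) (hA : ∀ i ∈ S, ‖t i‖ ^ 2 = α)
    (hB : ∀ i ∈ S, ∀ j ∈ S, i ≠ j → inner ℝ (t i) (t j) ≤ -β) :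
    ∀ i ∈ S, ∀ j ∈ S, i ≠ j → inner ℝ (t i) (t j) = -β := by
  classical
  intro i hi j hj hij
  have h1 := norm_sum_sq_le S t (fun i hi => (hA i hi).le) hB
  have h2 : ∑ k ∈ S, t k = 0 := by
    rw [← norm_eq_zero, ← pow_eq_zero_iff two_ne_zero]
    refine le_antisymm (h1.trans (le_of_eq ?_)) (sq_nonneg _)
    rw [hp, hpβ]; ring
  have h3 : inner ℝ (t i) (∑ k ∈ S, t k) = 0 := by rw [h2, inner_zero_right]
  have hj' : j ∈ S.erase i := mem_erase.2 ⟨hij.symm, hj⟩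
  rw [inner_sum, ← Finset.add_sum_erase S _ hi, ← Finset.add_sum_erase _ _ hj',
    real_inner_self_eq_norm_sq, hA i hi] at h3
  have h4 : ∑ k ∈ (S.erase i).erase j, inner ℝ (t i) (t k) ≤
      ∑ _k ∈ (S.erase i).erase j, -β := Finset.sum_le_sum fun k hk =>
    hB i hi k (mem_of_mem_erase (mem_of_mem_erase hk)) (ne_of_mem_erase (mem_of_mem_erase hk)).symm
  have h5 : ((S.erase i).erase j).card + 2 = p := by
    rw [card_erase_of_mem hj', card_erase_of_mem hi, hp]
    have : 2 ≤ p := by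
      rw [← hp]; exact Finset.one_lt_card.2 ⟨i, hi, j, hj, hij⟩
    omega
  rw [Finset.sum_const, nsmul_eq_mul] at h4
  have h6 : (((S.erase i).erase j).card : ℝ) = p - 2 := by
    rw [← h5]; push_cast; ring
  rw [h6] at h4
  refine le_antisymm (hB i hi j hj hij) ?_
  rw [hpβ] at h3
  linarith

end cross

/-- Either the code is small or it has exactly `p` blocks, whose pairs span lattice-like families. -/
theorem card_le_or_exists_families {α β : ℝ} (hα0 : 0 < α) (hα1 : α < 1) (hβ0 : 0 < β)
    (hβ1 : β < 1) {p : ℕ} (hp : 1 ≤ p) (hpβ : α = (p - 1) * β) :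
    ∃ K : ℝ, ∀ {E : Type} [NormedAddCommGroup E] [InnerProductSpace ℝ E] [FiniteDimensional ℝ E]
      (C : Finset E), IsUniacute α β C →
      (C.card : ℝ) ≤ (2 * p - 1 / 2) * Module.finrank ℝ E + K ∨
      ∃ (𝒯 : Finset E) (n : E → ℕ) (f : (t : E) → Fin (n t) → E), 𝒯.card = p ∧
        (C.card : ℝ) ≤ 3 / 2 * p * Module.finrank ℝ E + (∑ t ∈ 𝒯, (n t : ℝ)) / 2 + K ∧
        (∀ t ∈ 𝒯, Orthonormal ℝ (f t)) ∧
        ∀ s ∈ 𝒯, ∀ t ∈ 𝒯, s ≠ t → ∀ i j, ∃ m : ℤ,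
          (1 - α) / (α + β) * inner ℝ (f s i) (f t j) = m := by
  classical
  have hαβ : 0 < α + β := by linarith
  obtain ⟨η, N, hblocks⟩ := exists_blocks hα0 hα1 hβ0 hβ1 hp hpβ
  obtain ⟨K1, hK1⟩ := exists_card_block_le hα0 hα1 hβ0 N
  set δ : ℝ := min ((α + β) / 2) (1 - α) with hδ
  have hδ0 : 0 < δ := lt_min (by linarith) (by linarith)
  have hδ2 : 2 * δ ≤ α + β := by
    have : δ ≤ (α + β) / 2 := min_le_left _ _
    linarith
  have hδ1 : δ ≤ 1 - α := min_le_right _ _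
  obtain ⟨Q, hQ⟩ := exists_nat_gt (1 / δ ^ 2)
  obtain ⟨G, hG⟩ := exists_nat_gt (1 / (α + β) ^ 2)
  set K : ℝ := N + p * |K1| + Q + p * (p * G) with hK
  refine ⟨K, ?_⟩
  intro E _ _ _ C hC
  obtain ⟨𝒯, B, h𝒯, hcard, hBC, hdeg, hBt, hsep⟩ := hblocks C hC
  have hblk : ∀ t : E, ∃ ρ : ℕ, t ∈ 𝒯 →
      ((B t).card : ℝ) ≤ 3 / 2 * Module.finrank ℝ E + ρ / 2 + K1 ∧
        (0 < ρ → ∃ (a : E) (y : Fin ρ → E), IsPairSystem α (B t) a y) := by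
    intro t
    by_cases ht : t ∈ 𝒯
    · obtain ⟨ρ, hρ⟩ := hK1 (B t) (hC.subset (hBC t ht)) (hdeg t ht)
      exact ⟨ρ, fun _ => hρ⟩
    · exact ⟨0, fun h => absurd h ht⟩
  choose ρ hρ using hblk
  set d := Module.finrank ℝ E with hd
  have hρd : ∀ t ∈ 𝒯, ρ t ≤ d := by
    intro t ht
    rcases Nat.eq_zero_or_pos (ρ t) with h0 | h0
    · omega
    · obtain ⟨a, y, h⟩ := (hρ t ht).2 h0
      have := (h.orthonormal hα1).linearIndependent.fintype_card_le_finrank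
      simpa using this
  have hC1 : (C.card : ℝ) ≤ N + 𝒯.card * (3 / 2 * d + |K1|) + (∑ t ∈ 𝒯, (ρ t : ℝ)) / 2 := by
    have h1 : (C.card : ℝ) ≤ N + ∑ t ∈ 𝒯, ((B t).card : ℝ) := by exact_mod_cast hcard
    have h2 : ∑ t ∈ 𝒯, ((B t).card : ℝ) ≤ ∑ t ∈ 𝒯, ((3 / 2 * d + |K1|) + (ρ t : ℝ) / 2) :=
      Finset.sum_le_sum fun t ht => by
        have := (hρ t ht).1
        have := le_abs_self K1
        linarith
    rw [Finset.sum_add_distrib, Finset.sum_const, nsmul_eq_mul, ← Finset.sum_div] at h2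
    linarith
  have hd0 : (0 : ℝ) ≤ d := Nat.cast_nonneg _
  have hpG : (0 : ℝ) ≤ p * (p * G) := by positivity
  have hQ0 : (0 : ℝ) ≤ Q := Nat.cast_nonneg _
  have hK10 := abs_nonneg K1
  have hpR : (1 : ℝ) ≤ p := by exact_mod_cast hp
  by_cases hlt : 𝒯.card < p
  · left
    have h1 : ∑ t ∈ 𝒯, (ρ t : ℝ) ≤ 𝒯.card * d := by
      rw [← nsmul_eq_mul, ← Finset.sum_const]
      exact Finset.sum_le_sum fun t ht => by exact_mod_cast hρd t ht
    have h2 : (𝒯.card : ℝ) + 1 ≤ p := by exact_mod_cast hlt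
    have h3 : (𝒯.card : ℝ) * d ≤ (p - 1) * d := mul_le_mul_of_nonneg_right (by linarith) hd0
    have h4 : (𝒯.card : ℝ) * |K1| ≤ p * |K1| := mul_le_mul_of_nonneg_right (by linarith) hK10
    rw [hK]
    nlinarith
  have h𝒯p : 𝒯.card = p := le_antisymm h𝒯 (not_lt.1 hlt)
  rw [h𝒯p] at hC1
  -- One block with few pairs has about `3d/2` points and the others at most about `2d`, which gives
  -- `2p - 1/2`.
  by_cases hsmall : ∃ t ∈ 𝒯, ρ t ≤ Q
  · left
    obtain ⟨t, ht, htQ⟩ := hsmall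
    have h1 : ∑ s ∈ 𝒯, (ρ s : ℝ) ≤ Q + (p - 1) * d := by
      rw [← Finset.add_sum_erase _ _ ht]
      have h2 : ∑ s ∈ 𝒯.erase t, (ρ s : ℝ) ≤ ∑ _s ∈ 𝒯.erase t, (d : ℝ) :=
        Finset.sum_le_sum fun s hs => by exact_mod_cast hρd s (mem_of_mem_erase hs)
      rw [Finset.sum_const, card_erase_of_mem ht, h𝒯p, nsmul_eq_mul, Nat.cast_sub hp] at h2
      have h3 : (ρ t : ℝ) ≤ Q := by exact_mod_cast htQ
      push_cast at h2
      linarith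
    rw [hK]
    nlinarith
  right
  push Not at hsmall
  have hps : ∀ t : E, ∃ (a : E) (y : Fin (ρ t) → E), t ∈ 𝒯 → IsPairSystem α (B t) a y := by
    intro t
    by_cases ht : t ∈ 𝒯
    · obtain ⟨a, y, h⟩ := (hρ t ht).2 (lt_of_le_of_lt (Nat.zero_le _) (hsmall t ht))
      exact ⟨a, y, fun _ => h⟩
    · exact ⟨0, 0, fun h => absurd h ht⟩
  choose a y hy using hps
  have hyC : ∀ t ∈ 𝒯, IsPairSystem α C (a t) (y t) := fun t ht => (hy t ht).mono (hBC t ht)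
  have hcardδ : ∀ t ∈ 𝒯, 1 < (Fintype.card (Fin (ρ t)) : ℝ) * δ ^ 2 := by
    intro t ht
    rw [Fintype.card_fin]
    rw [div_lt_iff₀ (by positivity)] at hQ
    have : (Q : ℝ) ≤ ρ t := by exact_mod_cast (hsmall t ht).le
    nlinarith [sq_nonneg δ]
  have hmem : ∀ t ∈ 𝒯, ∀ x ∈ C, inner ℝ x (a t) = α ∨ inner ℝ x (a t) ≤ -β := fun t ht x hx =>
    (hyC t ht).mem_inner_center_or hC hα0 hα1 hδ0 hδ2 hδ1 (hcardδ t ht) hx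
  have hat : ∀ t ∈ 𝒯, α - η ≤ inner ℝ (a t) t := by
    intro t ht
    have hpos : 0 < ρ t := lt_of_le_of_lt (Nat.zero_le _) (hsmall t ht)
    have h1 := hBt t ht _ ((hy t ht).add_mem ⟨0, hpos⟩)
    have h2 := hBt t ht _ ((hy t ht).sub_mem ⟨0, hpos⟩)
    rw [inner_add_left] at h1
    rw [inner_sub_left] at h2
    linarith
  -- Each `a s` itself meets the hypotheses of `inner_center_or` for the system at `t`. The value
  -- `α` would mean `a s = a t`, which the separation of the blocks excludes.
  have hcross : ∀ s ∈ 𝒯, ∀ t ∈ 𝒯, s ≠ t → inner ℝ (a s) (a t) ≤ -β := by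
    intro s hs t ht hst
    refine ((hyC t ht).inner_center_or (β := β) hα0 hα1 ((hyC s hs).norm_center_le hα1) hδ0 hδ2
      (hcardδ t ht) fun i _ => ⟨?_, ?_⟩).resolve_left fun h => ?_
    · rw [real_inner_comm]; exact hmem s hs _ ((hyC t ht).add_mem i)
    · rw [real_inner_comm]; exact hmem s hs _ ((hyC t ht).sub_mem i)
    · have h1 : a s = a t := by
        rw [← sub_eq_zero, ← norm_eq_zero, ← pow_eq_zero_iff two_ne_zero, norm_sub_sq_real, h,
          (hyC s hs).norm_center, (hyC t ht).norm_center]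
        ring
      exact hsep s hs t ht hst (a s) (hyC s hs).norm_center (hat s hs) (h1 ▸ hat t ht)
  have heq := inner_eq_of_card_eq h𝒯p hpβ (fun t ht => (hyC t ht).norm_center) hcross
  -- Both `-β + z` and `-β - z` are `α` or at most `-β`, so `z` is `0` or `±(α + β)`. The same
  -- reasoning gives the integrality at the end.
  have hvals : ∀ s ∈ 𝒯, ∀ t ∈ 𝒯, ∀ i, inner ℝ (a s) (y t i) = 0 ∨
      α + β ≤ |inner ℝ (a s) (y t i)| := by
    intro s hs t ht i
    by_cases hst : s = t
    · subst hst
      exact Or.inl ((hyC s hs).inner_center i)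
    · have h1 := hmem s hs _ ((hyC t ht).add_mem i)
      have h2 := hmem s hs _ ((hyC t ht).sub_mem i)
      rw [real_inner_comm, inner_add_right, heq s hs t ht hst] at h1
      rw [real_inner_comm, inner_sub_right, heq s hs t ht hst] at h2
      rcases h1 with h1 | h1
      · right
        refine le_trans ?_ (le_abs_self _)
        linarith
      · rcases h2 with h2 | h2
        · right
          refine le_trans ?_ (neg_le_abs _)
          linarith
        · left; linarith
  -- Only the `y` orthogonal to every center are kept; by Bessel at most `G` are lost for each
  -- center.
  set S : (t : E) → Finset (Fin (ρ t)) := fun t =>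
    univ.filter (fun i => ∀ s ∈ 𝒯, inner ℝ (a s) (y t i) = 0) with hS
  have hScard : ∀ t ∈ 𝒯, ρ t ≤ (S t).card + p * G := by
    intro t ht
    have h1 := Finset.card_filter_add_card_filter_not (s := (univ : Finset (Fin (ρ t))))
      (fun i => ∀ s ∈ 𝒯, inner ℝ (a s) (y t i) = 0)
    rw [Finset.card_univ, Fintype.card_fin] at h1
    have h2 : (univ.filter (fun i => ¬ ∀ s ∈ 𝒯, inner ℝ (a s) (y t i) = 0)) ⊆
        𝒯.biUnion fun s => univ.filter (fun i => α + β ≤ |inner ℝ (a s) (y t i)|) := by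
      intro i hi
      have hi := (mem_filter.1 hi).2
      push Not at hi
      obtain ⟨s, hs, hi⟩ := hi
      exact mem_biUnion.2 ⟨s, hs, mem_filter.2 ⟨mem_univ _, (hvals s hs t ht i).resolve_left hi⟩⟩
    have h3 := (card_le_card h2).trans (card_biUnion_le_card_mul 𝒯 _ G fun s hs => ?_)
    · rw [h𝒯p] at h3
      simp only [hS]
      omega
    · have h4 := (hyC t ht).card_mul_sq_le hα0 hα1 ((hyC s hs).norm_center_le hα1) hαβ.le
        (univ.filter (fun i => α + β ≤ |inner ℝ (a s) (y t i)|)) fun i hi => (mem_filter.1 hi).2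
      rw [div_lt_iff₀ (by positivity)] at hG
      have h5 : (((univ.filter (fun i => α + β ≤ |inner ℝ (a s) (y t i)|)).card : ℕ) : ℝ) ≤ G := by
        have h6 : (0 : ℝ) < (α + β) ^ 2 := by positivity
        nlinarith
      exact_mod_cast h5
  refine ⟨𝒯, fun t => (S t).card, fun t i => (√(1 - α))⁻¹ • y t ((S t).equivFin.symm i), h𝒯p,
    ?_, fun t ht => ((hyC t ht).orthonormal hα1).comp (fun i => ((S t).equivFin.symm i : Fin (ρ t)))
      fun i j hij => (S t).equivFin.symm.injective (Subtype.ext hij), ?_⟩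
  · have h1 : ∑ t ∈ 𝒯, (ρ t : ℝ) ≤ ∑ t ∈ 𝒯, (((S t).card : ℝ) + p * G) :=
      Finset.sum_le_sum fun t ht => by exact_mod_cast hScard t ht
    rw [Finset.sum_add_distrib, Finset.sum_const, h𝒯p, nsmul_eq_mul] at h1
    rw [hK]
    linarith
  · intro s hs t ht hst i j
    set u := ((S s).equivFin.symm i : Fin (ρ s))
    set v := ((S t).equivFin.symm j : Fin (ρ t))
    have hu : ∀ r ∈ 𝒯, inner ℝ (a r) (y s u) = 0 :=
      (mem_filter.1 ((S s).equivFin.symm i).2).2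
    have hv : ∀ r ∈ 𝒯, inner ℝ (a r) (y t v) = 0 :=
      (mem_filter.1 ((S t).equivFin.symm j).2).2
    have hstβ := heq s hs t ht hst
    have hss : inner ℝ (a s) (a s) = α := by
      rw [real_inner_self_eq_norm_sq, (hyC s hs).norm_center]
    have hsmul : ∀ x : ℝ, 1 - α ≠ 0 → (1 - α) / (α + β) * ((√(1 - α))⁻¹ * ((√(1 - α))⁻¹ * x)) =
        x / (α + β) := by
      intro x hne
      rw [← mul_assoc (√(1 - α))⁻¹, ← mul_inv, Real.mul_self_sqrt (by linarith)]
      field_simp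
    have hval : ∀ x ∈ C, ∀ z ∈ C, inner ℝ (a s) x = α → inner ℝ (a s) z = -β →
        inner ℝ x z = α ∨ inner ℝ x z ≤ -β := by
      intro x hx z hz h1 h2
      refine hC.inner_or x hx z hz ?_
      rintro rfl
      linarith
    have h1 := hval _ ((hyC s hs).add_mem u) _ ((hyC t ht).add_mem v)
      (by rw [inner_add_right, hss, hu s hs, add_zero])
      (by rw [inner_add_right, hstβ, hv s hs, add_zero])
    have h2 := hval _ ((hyC s hs).add_mem u) _ ((hyC t ht).sub_mem v)
      (by rw [inner_add_right, hss, hu s hs, add_zero])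
      (by rw [inner_sub_right, hstβ, hv s hs, sub_zero])
    have hut : inner ℝ (y s u) (a t) = 0 := by rw [real_inner_comm]; exact hu t ht
    rw [inner_add_right, inner_add_left, inner_add_left, hstβ, hut, hv s hs] at h1
    rw [inner_sub_right, inner_add_left, inner_add_left, hstβ, hut, hv s hs] at h2
    rw [inner_smul_left, inner_smul_right, RCLike.conj_to_real, hsmul _ (by linarith)]
    rcases h1 with h1 | h1
    · refine ⟨1, ?_⟩
      rw [div_eq_iff hαβ.ne']; push_cast; linarith
    · rcases h2 with h2 | h2
      · refine ⟨-1, ?_⟩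
        rw [div_eq_iff hαβ.ne']; push_cast; linarith
      · refine ⟨0, ?_⟩
        rw [div_eq_iff hαβ.ne']; push_cast; linarith

/-! ### Assembling the bounds -/

/-- The size of uniacute codes in terms of the dimension. -/
theorem exists_card_le {α β : ℝ} (hα0 : 0 < α) (hα1 : α < 1) (hβ0 : 0 < β)
    (hβ1 : β < 1) {p : ℕ} (hp : 1 ≤ p) (hpβ : α = (p - 1) * β) {c : ℝ}
    (hc : (p = 2 ∧ (¬ ∃ n : ℤ, ((1 - α) / (α + β)) ^ 2 = n) ∧ c = 11 / 3) ∨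
      (3 ≤ p ∧ (¬ ∃ n : ℤ, (1 - α) / (α + β) = n) ∧ c = 2 * p - 1 / 2)) :
    ∃ K : ℝ, ∀ {E : Type} [NormedAddCommGroup E] [InnerProductSpace ℝ E] [FiniteDimensional ℝ E]
      (C : Finset E), IsUniacute α β C → (C.card : ℝ) ≤ c * Module.finrank ℝ E + K := by
  classical
  obtain ⟨K, hK⟩ := card_le_or_exists_families hα0 hα1 hβ0 hβ1 hp hpβ
  refine ⟨K, ?_⟩
  intro E _ _ _ C hC
  have hd0 : (0 : ℝ) ≤ Module.finrank ℝ E := Nat.cast_nonneg _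
  rcases hK C hC with h | ⟨𝒯, n, f, h𝒯, hcard, hf, hint⟩
  · refine h.trans (add_le_add_left (mul_le_mul_of_nonneg_right ?_ hd0) _)
    rcases hc with ⟨rfl, -, rfl⟩ | ⟨-, -, rfl⟩
    · norm_num
    · exact le_rfl
  rcases hc with ⟨rfl, hlam, rfl⟩ | ⟨hp3, hlam, rfl⟩
  · obtain ⟨s, t, hst, rfl⟩ := Finset.card_eq_two.1 h𝒯
    have h1 := card_add_card_le hlam (hf s (by simp)) (hf t (by simp))
      (hint s (by simp) t (by simp) hst)
    have h2 := card_add_card_le hlam (hf t (by simp)) (hf s (by simp))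
      (hint t (by simp) s (by simp) hst.symm)
    rw [Fintype.card_fin, Fintype.card_fin] at h1 h2
    rw [Finset.sum_pair hst] at hcard
    -- Adding the two asymmetric bounds; then `3d + (4d/3)/2 = 11d/3`.
    have h3 : (3 * (n s + n t) : ℝ) ≤ 4 * Module.finrank ℝ E := by
      have : 3 * (n s + n t) ≤ 4 * Module.finrank ℝ E := by omega
      exact_mod_cast this
    push_cast at hcard
    linarith
  · obtain ⟨r, s, t, hr, hs, ht, hrs, hrt, hst⟩ := (Finset.two_lt_card_iff (s := 𝒯)).1 (by omega)
    have h1 := card_add_card_add_card_le hlam (hf r hr) (hf s hs) (hf t ht)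
      (hint r hr s hs hrs) (hint s hs t ht hst) (hint t ht r hr hrt.symm)
    rw [Fintype.card_fin, Fintype.card_fin, Fintype.card_fin] at h1
    -- Three families have total size at most `2d` and each of the other `p - 3` at most `d`, so
    -- `3pd/2 + (p - 1)d/2 = (2p - 1/2)d`.
    have h1' : (n r + n s + n t : ℝ) ≤ 2 * Module.finrank ℝ E := by exact_mod_cast h1
    have hs' : s ∈ 𝒯.erase r := mem_erase.2 ⟨hrs.symm, hs⟩
    have ht' : t ∈ (𝒯.erase r).erase s := mem_erase.2 ⟨hst.symm, mem_erase.2 ⟨hrt.symm, ht⟩⟩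
    rw [← Finset.add_sum_erase _ _ hr, ← Finset.add_sum_erase _ _ hs',
      ← Finset.add_sum_erase _ _ ht'] at hcard
    have h2 : ∑ x ∈ ((𝒯.erase r).erase s).erase t, (n x : ℝ) ≤
        ∑ _x ∈ ((𝒯.erase r).erase s).erase t, (Module.finrank ℝ E : ℝ) := by
      refine Finset.sum_le_sum fun x hx => ?_
      have hx𝒯 := mem_of_mem_erase (mem_of_mem_erase (mem_of_mem_erase hx))
      have := (hf x hx𝒯).linearIndependent.fintype_card_le_finrank
      rw [Fintype.card_fin] at this
      exact_mod_cast this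
    rw [Finset.sum_const, card_erase_of_mem ht', card_erase_of_mem hs', card_erase_of_mem hr, h𝒯,
      nsmul_eq_mul, show p - 1 - 1 - 1 = p - 3 by omega, Nat.cast_sub hp3] at h2
    push_cast at h2
    nlinarith

/-- A bound for finite codes bounds `maxCodeSize`. -/
lemma maxCodeSize_le {α β : ℝ} {d : ℕ} {b : ℝ}
    (h : ∀ C : Finset (EuclideanSpace ℝ (Fin d)), IsUniacute α β C → (C.card : ℝ) ≤ b) :
    maxCodeSize (uniacuteSet α β) d ≠ ⊤ ∧
      ((maxCodeSize (uniacuteSet α β) d).toNat : ℝ) ≤ b := by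
  have hb : 0 ≤ b := by simpa using h ∅ ⟨by simp, by simp⟩
  have hfin : ∀ (C : Set (EuclideanSpace ℝ (Fin d))), IsSphericalCode (uniacuteSet α β) C →
      ∀ F : Finset (EuclideanSpace ℝ (Fin d)), (F : Set _) ⊆ C → F.card ≤ ⌊b⌋₊ := by
    intro C hC F hF
    refine Nat.le_floor (h F ⟨fun x hx => hC.1 x (hF hx), fun x hx y hy hxy => ?_⟩)
    rcases hC.2 x (hF hx) y (hF hy) hxy with h1 | h1
    · exact Or.inr h1.2
    · exact Or.inl h1
  have hle : maxCodeSize (uniacuteSet α β) d ≤ (⌊b⌋₊ : ℕ) := by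
    refine iSup₂_le fun C hC => ?_
    by_contra! hlt
    -- A code that is too large, possibly infinite, has a subcode of exactly `⌊b⌋₊ + 1` points, to
    -- which the finite bound applies.
    obtain ⟨D, hDC, hD⟩ := Set.exists_subset_encard_eq (Order.add_one_le_of_lt hlt)
    have hDfin : D.Finite := Set.finite_of_encard_eq_coe (k := ⌊b⌋₊ + 1) (by rw [hD]; rfl)
    have h1 := hfin C hC hDfin.toFinset (by simpa using hDC)
    rw [hDfin.encard_eq_coe_toFinset_card] at hD
    have h2 : hDfin.toFinset.card = ⌊b⌋₊ + 1 := by exact_mod_cast hD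
    omega
  refine ⟨ne_top_of_le_ne_top (ENat.natCast_ne_top _) hle, ?_⟩
  have h1 : (maxCodeSize (uniacuteSet α β) d).toNat ≤ ⌊b⌋₊ := by
    simpa using ENat.toNat_le_toNat hle (ENat.natCast_ne_top _)
  exact (Nat.cast_le.2 h1).trans (Nat.floor_le hb)

theorem mainTheorem6 (α β lam : ℝ) (p : ℤ)
    (hα : α ∈ Set.Ioo (0 : ℝ) 1) (hβ : β ∈ Set.Ioo (0 : ℝ) 1)
    (hlam : lam = (1 - α) / (α + β)) (hp : α / β + 1 = (p : ℝ)) :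
    (p = 2 → (¬ ∃ n : ℤ, lam ^ 2 = (n : ℝ)) →
      ∃ K : ℝ, ∀ d : ℕ, maxCodeSize (uniacuteSet α β) d ≠ ⊤ ∧
        ((maxCodeSize (uniacuteSet α β) d).toNat : ℝ) ≤ 11 * (d : ℝ) / 3 + K) ∧
    (3 ≤ p → (¬ ∃ n : ℤ, lam = (n : ℝ)) →
      ∃ K : ℝ, ∀ d : ℕ, maxCodeSize (uniacuteSet α β) d ≠ ⊤ ∧
        ((maxCodeSize (uniacuteSet α β) d).toNat : ℝ) ≤ (2 * (p : ℝ) - 1 / 2) * (d : ℝ) + K) := by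
  obtain ⟨hα0, hα1⟩ := hα
  obtain ⟨hβ0, hβ1⟩ := hβ
  subst hlam
  have hpβ : α = ((p : ℝ) - 1) * β := by
    rw [← hp]; field_simp; ring
  refine ⟨fun hp2 hn => ?_, fun hp3 hn => ?_⟩
  · subst hp2
    obtain ⟨K, hK⟩ := exists_card_le hα0 hα1 hβ0 hβ1 (p := 2) (by norm_num)
      (by push_cast at hpβ ⊢; exact hpβ) (c := 11 / 3) (Or.inl ⟨rfl, hn, rfl⟩)
    refine ⟨K, fun d => maxCodeSize_le fun C hC => (hK C hC).trans (le_of_eq ?_)⟩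
    rw [finrank_euclideanSpace_fin]; ring
  · lift p to ℕ using by omega
    obtain ⟨K, hK⟩ := exists_card_le hα0 hα1 hβ0 hβ1 (p := p) (by omega)
      (by exact_mod_cast hpβ) (c := 2 * p - 1 / 2) (Or.inr ⟨by omega, hn, rfl⟩)
    refine ⟨K, fun d => maxCodeSize_le fun C hC => (hK C hC).trans (le_of_eq ?_)⟩
    rw [finrank_euclideanSpace_fin]; push_cast; ring
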